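/- Let $a>0$ and consider the Schrödinger operator $-\frac{d^2}{dx^2}+U$ on $L^2(\mathbb R)$ with $$U(x)=4-24\,\frac{1+\cosh(2x)\cosh(2a)}{(\cosh(2x)+\cosh(2a))^2}$$ (the linearization of $\phi_{tt}-\phi_{xx}+V'(\phi)=0$, $V(\phi)=2\phi^2(\phi-\tanh a)(\phi-\coth a)$, about the static lump $\phi(x)=\sinh(2a)/(\cosh(2a)+\cosh(2x))$, i.e. $U(x)=V''(\phi(x))$). For a real number $\lambda<4$ put $$\alpha=\tfrac12\sqrt{4-\lambda}+3,\quad \beta=\tfrac12(\sqrt{4-\lambda}+7),\quad \gamma=\sqrt{4-\lambda}+1,\quad \delta=\tfrac12,$$ $$p=-\frac1{\sinh^2 a},\qquad q=\frac{6\cosh(2a)(\sqrt{4-\lambda}+3)-(\sqrt{4-\lambda}+6)(\sqrt{4-\lambda}+1)}{4\sinh^2 a}.$$ Let $H\ell(p,q;\alpha,\beta,\gamma,\delta;z)$ denote the local Heun function, i.e. the sum of the power series at $z=0$ with value $1$ at $z=0$ solving Heun's equation $$H''+\Big(\frac{\gamma}{z}+\frac{\delta}{z-1}+\frac{\alpha+\beta-\gamma-\delta+1}{z-p}\Big)H'+\frac{\alpha\beta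 z-q}{z(z-1)(z-p)}H=0 .$$ **Theorem.** The operator $-\frac{d^2}{dx^2}+U$ has a least eigenvalue $\lambda_{-1}$ (the ground-state eigenvalue), and $\lambda_{-1}<0$. Its eigenfunctions are exactly the nonzero constant multiples of $$\eta_{-1}(x)=\operatorname{sech}(x)^{\sqrt{4-\lambda_{-1}}}\,\big(\sinh^2(a)\operatorname{sech}^2(x)+1\big)^3\,H\ell\big(1-p,\ \alpha\beta-q;\ \alpha,\beta,\delta,\gamma;\ \tanh^2 x\big)\Big|_{\lambda=\lambda_{-1}},$$ where the power series defining $H\ell$ converges at $\tanh^2x$ for every real $x$. The function $\eta_{-1}$ is even and has no zeros. -/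

import Mathlib

/-- The potential `U` of the Schrödinger operator `-d²/dx² + U` obtained by linearising
`φ_tt - φ_xx + V'(φ) = 0`, `V(φ) = 2 φ² (φ - tanh a)(φ - coth a)`, about the static lump
`φ(x) = sinh (2a) / (cosh (2a) + cosh (2x))`, that is, `U(x) = V''(φ(x))`. -/
noncomputable def lumpPotential (a x : ℝ) : ℝ :=
  4 - 24 * (1 + Real.cosh (2 * x) * Real.cosh (2 * a)) /
    (Real.cosh (2 * x) + Real.cosh (2 * a)) ^ 2

/-- `η` is an eigenfunction of `-d²/dx² + U` on `L²(ℝ)` with eigenvalue `lam`: a nonzero, square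
integrable, twice continuously differentiable solution of `-η'' + U η = lam η`. -/
structure IsEigenfunction (U : ℝ → ℝ) (lam : ℝ) (η : ℝ → ℝ) : Prop where
  contDiff : ContDiff ℝ 2 η
  memLp : MeasureTheory.MemLp η 2 MeasureTheory.volume
  ne_zero : η ≠ 0
  eqn : ∀ x, -deriv (deriv η) x + U x * η x = lam * η x

/-- `lam` is the ground-state eigenvalue of `-d²/dx² + U`: its least eigenvalue. -/
def IsGroundStateEigenvalue (U : ℝ → ℝ) (lam : ℝ) : Prop :=
  IsLeast {l : ℝ | ∃ η : ℝ → ℝ, IsEigenfunction U l η} lam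

/-- The Frobenius coefficients at `z = 0`, exponent `0`, normalised by `c₀ = 1`, of Heun's equation
`H'' + (γ/z + δ/(z-1) + ε/(z-p)) H' + (αβz - q)/(z(z-1)(z-p)) H = 0`,
with `ε = α + β - γ - δ + 1` (for `p ≠ 0` and `γ ≠ 0, -1, -2, …`). They satisfy
`p γ c₁ = q c₀` and, for `j ≥ 1`, `R_j c_{j+1} - (Q_j + q) c_j + P_j c_{j-1} = 0`, where
`R_j = p (j+1)(j+γ)`, `Q_j = j ((j-1+γ)(1+p) + pδ + ε)`, `P_j = (j-1+α)(j-1+β)`.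
(The clause for `n + 2` is this relation with `j = n + 1`.) -/
noncomputable def heunCoeff (p q α β γ δ : ℝ) : ℕ → ℝ
  | 0 => 1
  | 1 => q / (p * γ)
  | n + 2 =>
      ((((n : ℝ) + 1) * (((n : ℝ) + γ) * (1 + p) + p * δ + (α + β - γ - δ + 1)) + q) *
            heunCoeff p q α β γ δ (n + 1) -
          ((n : ℝ) + α) * ((n : ℝ) + β) * heunCoeff p q α β γ δ n) /
        (p * ((n : ℝ) + 2) * ((n : ℝ) + 1 + γ))

/-- The local Heun function `Hℓ(p, q; α, β, γ, δ; z)`: the solution of Heun's equation that is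
analytic at `z = 0` with value `1` there, given by its power series (`|z| < min 1 |p|`). -/
noncomputable def localHeun (p q α β γ δ z : ℝ) : ℝ :=
  ∑' n : ℕ, heunCoeff p q α β γ δ n * z ^ n

/-- `p = -1 / sinh² a`. -/
noncomputable def heunP (a : ℝ) : ℝ := -1 / Real.sinh a ^ 2

/-- The accessory parameter `q`. -/
noncomputable def heunQ (a lam : ℝ) : ℝ :=
  (6 * Real.cosh (2 * a) * (Real.sqrt (4 - lam) + 3) -
      (Real.sqrt (4 - lam) + 6) * (Real.sqrt (4 - lam) + 1)) / (4 * Real.sinh a ^ 2)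

/-- `α = √(4 - lam) / 2 + 3`. -/
noncomputable def heunAlpha (lam : ℝ) : ℝ := Real.sqrt (4 - lam) / 2 + 3

/-- `β = (√(4 - lam) + 7) / 2`. -/
noncomputable def heunBeta (lam : ℝ) : ℝ := (Real.sqrt (4 - lam) + 7) / 2

/-- `γ = √(4 - lam) + 1`. -/
noncomputable def heunGamma (lam : ℝ) : ℝ := Real.sqrt (4 - lam) + 1

/-- `δ = 1/2`. -/
noncomputable def heunDelta : ℝ := 1 / 2

/-- The closed form
`sech(x)^√(4-lam) (sinh² a sech² x + 1)³ Hℓ(1-p, αβ-q; α, β, δ, γ; tanh² x)`;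
note that `γ` and `δ` are interchanged. -/
noncomputable def heunMode (a lam x : ℝ) : ℝ :=
  (1 / Real.cosh x) ^ Real.sqrt (4 - lam) *
    (Real.sinh a ^ 2 * (1 / Real.cosh x) ^ 2 + 1) ^ 3 *
    localHeun (1 - heunP a) (heunAlpha lam * heunBeta lam - heunQ a lam)
      (heunAlpha lam) (heunBeta lam) heunDelta (heunGamma lam) (Real.tanh x ^ 2)

/-- A solution of `u'' = V u` on the line with vanishing Cauchy data vanishes. -/
theorem linearODE_eq_zero {V u u₁ : ℝ → ℝ} {M : ℝ} (hV : ∀ x, |V x| ≤ M)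
    (hu : ∀ x, HasDerivAt u (u₁ x) x) (hu₁ : ∀ x, HasDerivAt u₁ (V x * u x) x)
    {x₀ : ℝ} (h0 : u x₀ = 0) (h1 : u₁ x₀ = 0) (x : ℝ) : u x = 0 := by
  -- Grönwall by hand: `E = u² + u₁²` satisfies `|E'| ≤ (1 + M) E`, so an exponential weight makes
  -- it monotone on either side of `x₀`.
  have hE : ∀ x, HasDerivAt (fun y => u y ^ 2 + u₁ y ^ 2)
      (2 * u x * u₁ x + 2 * u₁ x * (V x * u x)) x := fun x => 
    (((hu x).pow 2).add ((hu₁ x).pow 2)).congr_deriv (by norm_num)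
  have hb : ∀ x, |2 * u x * u₁ x + 2 * u₁ x * (V x * u x)| ≤
      (1 + M) * (u x ^ 2 + u₁ x ^ 2) := fun x => by
    have e : 2 * u x * u₁ x + 2 * u₁ x * (V x * u x) = (1 + V x) * (2 * u x * u₁ x) := by ring
    rw [e, abs_mul]
    have h2 : |1 + V x| ≤ 1 + M := (abs_add_le _ _).trans (by simpa using hV x)
    have h3 : |2 * u x * u₁ x| ≤ u x ^ 2 + u₁ x ^ 2 :=
      abs_le.2 ⟨by nlinarith [sq_nonneg (u x + u₁ x)], by nlinarith [sq_nonneg (u x - u₁ x)]⟩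
    exact mul_le_mul h2 h3 (abs_nonneg _) ((abs_nonneg _).trans h2)
  have hexp : ∀ c x : ℝ, HasDerivAt (fun y => Real.exp (c * y)) (Real.exp (c * x) * c) x :=
    fun c x => by simpa using ((hasDerivAt_id x).const_mul c).exp
  have key : u x ^ 2 + u₁ x ^ 2 ≤ 0 := by
    rcases le_total x₀ x with h | h
    · have hanti : Antitone fun y => (u y ^ 2 + u₁ y ^ 2) * Real.exp (-(1 + M) * y) :=
        antitone_of_hasDerivAt_nonpos (fun y => (hE y).mul (hexp _ y)) fun y => by
          have := (abs_le.1 (hb y)).2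
          have h5 := Real.exp_pos (-(1 + M) * y)
          simp only [Pi.zero_apply]
          nlinarith
      have h6 := hanti h
      simp only [h0, h1] at h6
      have h5 := Real.exp_pos (-(1 + M) * x)
      by_contra! h7
      have := mul_pos h7 h5
      simp only [ne_eq, OfNat.ofNat_ne_zero, not_false_eq_true, zero_pow, add_zero, zero_mul] at h6
      linarith
    · have hmono : Monotone fun y => (u y ^ 2 + u₁ y ^ 2) * Real.exp ((1 + M) * y) :=
        monotone_of_hasDerivAt_nonneg (fun y => (hE y).mul (hexp _ y)) fun y => by
          have := (abs_le.1 (hb y)).1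
          have h5 := Real.exp_pos ((1 + M) * y)
          simp only [Pi.zero_apply]
          nlinarith
      have h6 := hmono h
      simp only [h0, h1] at h6
      have h5 := Real.exp_pos ((1 + M) * x)
      by_contra! h7
      have := mul_pos h7 h5
      simp only [ne_eq, OfNat.ofNat_ne_zero, not_false_eq_true, zero_pow, add_zero, zero_mul] at h6
      linarith
  nlinarith [sq_nonneg (u x), sq_nonneg (u₁ x)]

/-- A positive solution of `u'' = V u` with `V ≤ K²` has `u'/u ≥ -K`. -/
theorem neg_mul_le_deriv_of_pos {V u u₁ : ℝ → ℝ} {K : ℝ} (hK : 0 < K) (hV : ∀ x, V x ≤ K ^ 2)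
    (hu : ∀ x, HasDerivAt u (u₁ x) x) (hu₁ : ∀ x, HasDerivAt u₁ (V x * u x) x)
    (hpos : ∀ x, 0 < u x) (x : ℝ) : -K * u x ≤ u₁ x := by
  by_contra! hlt
  set h₀ := -(u₁ x + K * u x) with hh₀
  have hh₀pos : 0 < h₀ := by rw [hh₀]; linarith
  have hexp : ∀ y : ℝ, HasDerivAt (fun y => Real.exp (-K * y)) (Real.exp (-K * y) * (-K)) y :=
    fun y => by simpa using ((hasDerivAt_id y).const_mul (-K)).exp
  -- Once `u₁ + K u` is negative it stays below `-h₀`; then `u` lies below a line of slope `-h₀`,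
  -- which reaches zero at `x + u x / h₀`.
  have hanti : Antitone fun y => (u₁ y + K * u y) * Real.exp (-K * y) :=
    antitone_of_hasDerivAt_nonpos
      (fun y => ((hu₁ y).add ((hu y).const_mul K)).mul (hexp y)) fun y => by
      have h5 := Real.exp_pos (-K * y)
      have := mul_le_mul_of_nonneg_right (hV y) (hpos y).le
      simp only [Pi.zero_apply, Pi.add_apply]
      have e : (V y * u y + K * u₁ y) * Real.exp (-K * y) +
        (u₁ y + K * u y) * (Real.exp (-K * y) * -K) =
        -((K ^ 2 * u y - V y * u y) * Real.exp (-K * y)) := by ring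
      rw [e]
      exact neg_nonpos.2 (mul_nonneg (by linarith) h5.le)
  have hneg : ∀ y, x ≤ y → u₁ y ≤ -h₀ := fun y hy => by
    have h6 := hanti hy
    simp only at h6
    have h7 : Real.exp (-K * y) ≤ Real.exp (-K * x) := Real.exp_le_exp.2 (by nlinarith)
    have h8 := Real.exp_pos (-K * y)
    have h9 : (u₁ y + K * u y) * Real.exp (-K * y) ≤ -h₀ * Real.exp (-K * y) := by
      refine h6.trans ?_
      have : u₁ x + K * u x = -h₀ := by rw [hh₀]; ring
      rw [this]
      nlinarith
    have h10 := le_of_mul_le_mul_right h9 h8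
    nlinarith [hpos y]
  have hlin : AntitoneOn (fun y => u y + h₀ * y) (Set.Ici x) := by
    have hd : ∀ y, HasDerivAt (fun y => u y + h₀ * y) (u₁ y + h₀) y := fun y =>
      ((hu y).add ((hasDerivAt_id y).const_mul h₀)).congr_deriv (by simp)
    refine antitoneOn_of_deriv_nonpos (convex_Ici x)
      (fun y _ => (hd y).continuousAt.continuousWithinAt)
      (fun y _ => (hd y).differentiableAt.differentiableWithinAt) fun y hy => ?_
    rw [interior_Ici] at hy
    rw [(hd y).deriv]
    linarith [hneg y hy.le]
  have hx : x ≤ x + u x / h₀ := by have := div_pos (hpos x) hh₀pos; linarith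
  have := hlin Set.self_mem_Ici hx hx
  simp only at this
  have e : h₀ * (x + u x / h₀) = h₀ * x + u x := by field_simp
  linarith [hpos (x + u x / h₀)]

/-- Reflection of a solution of `u'' = V u`. -/
theorem hasDerivAt_reflect {V u u₁ : ℝ → ℝ}
    (hu : ∀ x, HasDerivAt u (u₁ x) x) (hu₁ : ∀ x, HasDerivAt u₁ (V x * u x) x) :
    (∀ x, HasDerivAt (fun y => u (-y)) (-u₁ (-x)) x) ∧
      ∀ x, HasDerivAt (fun y => -u₁ (-y)) (V (-x) * u (-x)) x := by
  refine ⟨fun x => ?_, fun x => ?_⟩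
  · exact ((hu (-x)).comp x (hasDerivAt_neg x)).congr_deriv (by simp)
  · exact ((hu₁ (-x)).comp x (hasDerivAt_neg x)).neg.congr_deriv (by simp)

/-- A positive solution of `u'' = V u` with `V ≤ K²` has `u'/u ≤ K`. -/
theorem deriv_le_mul_of_pos {V u u₁ : ℝ → ℝ} {K : ℝ} (hK : 0 < K) (hV : ∀ x, V x ≤ K ^ 2)
    (hu : ∀ x, HasDerivAt u (u₁ x) x) (hu₁ : ∀ x, HasDerivAt u₁ (V x * u x) x)
    (hpos : ∀ x, 0 < u x) (x : ℝ) : u₁ x ≤ K * u x := by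
  obtain ⟨h1, h2⟩ := hasDerivAt_reflect hu hu₁
  have := neg_mul_le_deriv_of_pos (V := fun x => V (-x)) hK (fun x => hV (-x)) h1 h2
    (fun x => hpos (-x)) (-x)
  simp only [neg_neg] at this
  linarith

/-- There is no nonnegative integrable `g` with `g' ≥ c - K g`, `c > 0`, on a right half line. -/
theorem false_of_integrable_of_deriv_ge {g g₁ : ℝ → ℝ} {c K x₀ : ℝ} (hc : 0 < c) (hK : 0 < K)
    (hg : ∀ x, HasDerivAt g (g₁ x) x) (hg0 : ∀ x, 0 ≤ g x) (hint : MeasureTheory.Integrable g)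
    (hge : ∀ x, x₀ ≤ x → c - K * g x ≤ g₁ x) : False := by
  have hcont : Continuous g := continuous_iff_continuousAt.2 fun x => (hg x).continuousAt
  set I := ∫ x, g x with hI
  have hIle : ∀ x, x₀ ≤ x → ∫ t in x₀..x, g t ≤ I := fun x hx => by
    rw [intervalIntegral.integral_of_le hx]
    exact MeasureTheory.setIntegral_le_integral hint (Filter.Eventually.of_forall hg0)
  have hG : ∀ x, HasDerivAt (fun x => ∫ t in x₀..x, g t) (g x) x := fun x =>
    intervalIntegral.integral_hasDerivAt_right (hcont.intervalIntegrable _ _)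
      (hcont.stronglyMeasurableAtFilter _ _) hcont.continuousAt
  have hd : ∀ x, HasDerivAt (fun x => g x + K * (∫ t in x₀..x, g t) - c * x)
      (g₁ x + K * g x - c) x := fun x =>
    (((hg x).add ((hG x).const_mul K)).sub ((hasDerivAt_id x).const_mul c)).congr_deriv (by simp)
  -- As the integral of `g` is at most `I`, this monotonicity makes `g` grow at least linearly. The
  -- point `X` below is where the lower bound for `g` has reached `1`, even if `I` is replaced by
  -- `|I|`.
  have hmono : MonotoneOn (fun x => g x + K * (∫ t in x₀..x, g t) - c * x) (Set.Ici x₀) := by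
    refine monotoneOn_of_deriv_nonneg (convex_Ici x₀)
      (fun y _ => (hd y).continuousAt.continuousWithinAt)
      (fun y _ => (hd y).differentiableAt.differentiableWithinAt) fun y hy => ?_
    rw [interior_Ici] at hy
    rw [(hd y).deriv]
    linarith [hge y hy.le]
  have hlow : ∀ x, x₀ ≤ x → c * (x - x₀) - K * I ≤ g x := fun x hx => by
    have := hmono Set.self_mem_Ici hx hx
    simp only [intervalIntegral.integral_same] at this
    nlinarith [hIle x hx, hg0 x₀]
  set X := x₀ + (1 + K * |I|) / c with hX
  have hsub : Set.Ici X ⊆ {x | (1 : ℝ) ≤ ‖g x‖} := fun x hx => by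
    have hx' : X ≤ x := hx
    have h1 : 0 ≤ (1 + K * |I|) / c := by positivity
    have h2 : c * (X - x₀) = 1 + K * |I| := by rw [hX]; field_simp; ring
    have h3 := hlow x (by linarith)
    have h4 : K * I ≤ K * |I| := mul_le_mul_of_nonneg_left (le_abs_self I) hK.le
    have h5 : c * (X - x₀) ≤ c * (x - x₀) := mul_le_mul_of_nonneg_left (by linarith) hc.le
    rw [Set.mem_ofPred_eq, Real.norm_of_nonneg (hg0 x)]
    linarith
  have h1 := hint.measure_norm_ge_lt_top one_pos
  have h2 := MeasureTheory.measure_mono (μ := MeasureTheory.volume) hsub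
  rw [Real.volume_Ici] at h2
  exact absurd (h2.trans_lt h1) (by simp)

/-- Picone's argument: if `ψ'' = V ψ` has a positive solution, then a square integrable solution of
`η'' = (V + d) η` with `d ≥ 0` is a multiple of `ψ`, and zero unless `d = 0`. -/
theorem eq_const_mul_of_pos_solution {V ψ ψ₁ η η₁ : ℝ → ℝ} {K d : ℝ} (hK : 0 < K)
    (hV : ∀ x, V x ≤ K ^ 2) (hψ : ∀ x, HasDerivAt ψ (ψ₁ x) x)
    (hψ₁ : ∀ x, HasDerivAt ψ₁ (V x * ψ x) x) (hpos : ∀ x, 0 < ψ x) (hd : 0 ≤ d)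
    (hη : ∀ x, HasDerivAt η (η₁ x) x) (hη₁ : ∀ x, HasDerivAt η₁ ((V x + d) * η x) x)
    (hint : MeasureTheory.Integrable fun x => η x ^ 2) :
    (∀ x, d * η x ^ 2 = 0) ∧ ∃ c, ∀ x, η x = c * ψ x := by
  -- Picone's function: `F'` is a square plus `d η²`, and `(η²)' = 2F + 2(ψ₁/ψ)η²` with `|ψ₁/ψ| ≤
  -- K`. A positive value of `F` would contradict integrability of `η²` at `+∞`, a negative one at
  -- `-∞`.
  set F : ℝ → ℝ := fun x => η x * η₁ x - ψ₁ x / ψ x * η x ^ 2 with hF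
  have hF' : ∀ x, HasDerivAt F ((η₁ x - ψ₁ x / ψ x * η x) ^ 2 + d * η x ^ 2) x := fun x => by
    have h := ((hη x).mul (hη₁ x)).sub
      (((hψ₁ x).div (hψ x) (hpos x).ne').mul ((hη x).pow 2))
    refine h.congr_deriv ?_
    have := (hpos x).ne'
    simp only [Pi.pow_apply, Pi.div_apply]
    field_simp
    push_cast
    ring
  have hmono : Monotone F := monotone_of_hasDerivAt_nonneg hF' fun x => by
    simp only [Pi.zero_apply]; positivity
  have hg : ∀ x, HasDerivAt (fun x => η x ^ 2) (2 * (η x * η₁ x)) x := fun x => by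
    have := (hη x).pow 2
    refine this.congr_deriv ?_
    norm_num; ring
  have hFg : ∀ x, η x * η₁ x = F x + ψ₁ x / ψ x * η x ^ 2 := fun x => by simp [hF]
  have hle : ∀ x, F x ≤ 0 := fun x₀ => by
    by_contra! hlt
    refine false_of_integrable_of_deriv_ge (c := 2 * F x₀) (K := 2 * K) (x₀ := x₀) (by linarith)
      (by linarith) hg (fun x => sq_nonneg _) hint fun x hx => ?_
    have h1 := hmono hx
    have h2 : -K ≤ ψ₁ x / ψ x := by
      rw [le_div_iff₀ (hpos x)]; exact neg_mul_le_deriv_of_pos hK hV hψ hψ₁ hpos x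
    rw [hFg]
    nlinarith [mul_le_mul_of_nonneg_right h2 (sq_nonneg (η x))]
  have hge : ∀ x, 0 ≤ F x := fun x₀ => by
    by_contra! hlt
    have hg' : ∀ x, HasDerivAt (fun x => η (-x) ^ 2) (-(2 * (η (-x) * η₁ (-x)))) x := fun x => by
      have := (hg (-x)).comp x (hasDerivAt_neg x)
      simpa [Function.comp_def] using this
    refine false_of_integrable_of_deriv_ge (c := 2 * -F x₀) (K := 2 * K) (x₀ := -x₀) (by linarith)
      (by linarith) hg' (fun x => sq_nonneg _) hint.comp_neg fun x hx => ?_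
    have h1 : F (-x) ≤ F x₀ := hmono (by linarith)
    have h2 : ψ₁ (-x) / ψ (-x) ≤ K := by
      rw [div_le_iff₀ (hpos _)]; exact deriv_le_mul_of_pos hK hV hψ hψ₁ hpos _
    rw [hFg]
    nlinarith [mul_le_mul_of_nonneg_right h2 (sq_nonneg (η (-x)))]
  have hzero : ∀ x, F x = 0 := fun x => le_antisymm (hle x) (hge x)
  have hder : ∀ x, (η₁ x - ψ₁ x / ψ x * η x) ^ 2 + d * η x ^ 2 = 0 := fun x => by
    have h1 := hF' x
    have : F = fun _ => 0 := funext hzero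
    rw [this] at h1
    exact h1.unique (hasDerivAt_const x 0)
  have hparts : ∀ x, (η₁ x - ψ₁ x / ψ x * η x) = 0 ∧ d * η x ^ 2 = 0 := fun x => by
    have h1 : 0 ≤ d * η x ^ 2 := by positivity
    have h2 := sq_nonneg (η₁ x - ψ₁ x / ψ x * η x)
    have h3 := hder x
    exact ⟨pow_eq_zero_iff (two_ne_zero) |>.1 (by linarith), by linarith⟩
  refine ⟨fun x => (hparts x).2, η 0 / ψ 0, fun x => ?_⟩
  have hq : ∀ x, HasDerivAt (fun x => η x / ψ x) 0 x := fun x => by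
    refine ((hη x).div (hψ x) (hpos x).ne').congr_deriv ?_
    have h1 := (hparts x).1
    have h2 := (hpos x).ne'
    field_simp at h1 ⊢
    linarith
  have := is_const_of_deriv_eq_zero (fun x => (hq x).differentiableAt) (fun x => (hq x).deriv) x 0
  rw [← this, div_mul_cancel₀ _ (hpos x).ne']

/-- A solution of `u'' = V u` with `V ≥ 0` to the right of `X` that is positive and nondecreasing
at `X` stays positive. -/
theorem pos_of_growth {V u u₁ : ℝ → ℝ} {X : ℝ} (hV : ∀ x, X ≤ x → 0 ≤ V x)
    (hu : ∀ x, HasDerivAt u (u₁ x) x) (hu₁ : ∀ x, HasDerivAt u₁ (V x * u x) x)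
    (h0 : 0 < u X) (h1 : 0 ≤ u₁ X) (x : ℝ) (hx : X ≤ x) : 0 < u x := by
  -- `(u u₁)' = u₁² + V u² ≥ 0`, so `u u₁` stays nonnegative and `u²` cannot come down to zero.
  have hmono : MonotoneOn (fun y => u y * u₁ y) (Set.Ici X) := by
    have hd := fun y => (hu y).mul (hu₁ y)
    refine monotoneOn_of_deriv_nonneg (convex_Ici X)
      (fun y _ => (hd y).continuousAt.continuousWithinAt)
      (fun y _ => (hd y).differentiableAt.differentiableWithinAt) fun y hy => ?_
    rw [interior_Ici] at hy
    refine (hd y).deriv.symm ▸ ?_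
    have := mul_nonneg (hV y hy.le) (sq_nonneg (u y))
    nlinarith [sq_nonneg (u₁ y)]
  have hsq : MonotoneOn (fun y => u y ^ 2) (Set.Ici X) := by
    have hd := fun y => (hu y).pow 2
    refine monotoneOn_of_deriv_nonneg (convex_Ici X)
      (fun y _ => (hd y).continuousAt.continuousWithinAt)
      (fun y _ => (hd y).differentiableAt.differentiableWithinAt) fun y hy => ?_
    rw [interior_Ici] at hy
    refine (hd y).deriv.symm ▸ ?_
    have h2 := hmono Set.self_mem_Ici (Set.mem_Ici.2 (le_of_lt hy)) (le_of_lt hy)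
    have h3 := mul_nonneg h0.le h1
    simp only at h2
    norm_num
    nlinarith
  by_contra! hneg
  have hcont : ContinuousOn u (Set.Icc X x) :=
    fun y _ => (hu y).continuousAt.continuousWithinAt
  obtain ⟨y, hy, hy0⟩ := intermediate_value_Icc' hx hcont ⟨hneg, h0.le⟩
  have := hsq Set.self_mem_Ici hy.1 hy.1
  simp only [hy0] at this
  nlinarith

/-- A positive nonincreasing solution of `u'' = V u` with `V ≥ 1` decays exponentially. -/
theorem exp_decay_of_antitone {V u u₁ : ℝ → ℝ} {X : ℝ} (hV : ∀ x, X ≤ x → 1 ≤ V x)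
    (hu : ∀ x, HasDerivAt u (u₁ x) x) (hu₁ : ∀ x, HasDerivAt u₁ (V x * u x) x)
    (hpos : ∀ x, X ≤ x → 0 < u x) (hneg : ∀ x, X ≤ x → u₁ x ≤ 0) (x : ℝ) (hx : X ≤ x) :
    u x ≤ u X * Real.exp X * Real.exp (-x) := by
  have hanti : AntitoneOn u (Set.Ici X) := by
    refine antitoneOn_of_deriv_nonpos (convex_Ici X)
      (fun y _ => (hu y).continuousAt.continuousWithinAt)
      (fun y _ => (hu y).differentiableAt.differentiableWithinAt) fun y hy => ?_
    rw [interior_Ici] at hy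
    rw [(hu y).deriv]
    exact hneg y hy.le
  have hexpn : ∀ y : ℝ, HasDerivAt (fun y => Real.exp (-y)) (-Real.exp (-y)) y :=
    fun y => by simpa using (hasDerivAt_neg y).exp
  have hmono : MonotoneOn (fun y => (u₁ y + u y) * Real.exp (-y)) (Set.Ici X) := by
    have hd := fun y => ((hu₁ y).add (hu y)).mul (hexpn y)
    refine monotoneOn_of_deriv_nonneg (convex_Ici X)
      (fun y _ => (hd y).continuousAt.continuousWithinAt)
      (fun y _ => (hd y).differentiableAt.differentiableWithinAt) fun y hy => ?_
    rw [interior_Ici] at hy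
    refine (hd y).deriv.symm ▸ ?_
    simp only [Pi.add_apply]
    have e : (V y * u y + u₁ y) * Real.exp (-y) + (u₁ y + u y) * -Real.exp (-y) =
      (V y - 1) * u y * Real.exp (-y) := by ring
    rw [e]
    exact mul_nonneg (mul_nonneg (by linarith [hV y hy.le]) (hpos y hy.le).le)
      (Real.exp_pos _).le
  -- If `u₁ + u` were positive at some point it would grow exponentially, whereas `u₁ ≤ 0` bounds it
  -- by `u X`. The inequality says that `u eʸ` is nonincreasing.
  have hle : ∀ y, X ≤ y → u₁ y + u y ≤ 0 := fun y hy => by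
    by_contra! hlt
    set h := u₁ y + u y
    have hbig : ∀ z, y ≤ z → h * Real.exp (z - y) ≤ u X := fun z hz => by
      have h1 := hmono hy (hy.trans hz) hz
      simp only at h1
      have h2 := hneg z (hy.trans hz)
      have h3 := hanti Set.self_mem_Ici (hy.trans hz) (hy.trans hz)
      have h4 := Real.exp_pos z
      have h5 : Real.exp (-z) * Real.exp z = 1 := by rw [← Real.exp_add]; simp
      have h6 : Real.exp (z - y) = Real.exp (-y) * Real.exp z := by rw [← Real.exp_add]; ring_nf
      have h7 := mul_le_mul_of_nonneg_right h1 h4.le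
      rw [h6]
      calc h * (Real.exp (-y) * Real.exp z) = h * Real.exp (-y) * Real.exp z := by ring
        _ ≤ (u₁ z + u z) * Real.exp (-z) * Real.exp z := h7
        _ = u₁ z + u z := by rw [mul_assoc, h5, mul_one]
        _ ≤ u X := by linarith
    have h0 : 0 < u X / h := div_pos (hpos X le_rfl) hlt
    have h8 := hbig (y + u X / h) (by linarith)
    have h9 := Real.add_one_le_exp (u X / h)
    rw [add_sub_cancel_left] at h8
    have h10 : h * (u X / h) = u X := by field_simp
    nlinarith
  have hanti2 : AntitoneOn (fun y => u y * Real.exp y) (Set.Ici X) := by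
    have hd := fun y => (hu y).mul (Real.hasDerivAt_exp y)
    refine antitoneOn_of_deriv_nonpos (convex_Ici X)
      (fun y _ => (hd y).continuousAt.continuousWithinAt)
      (fun y _ => (hd y).differentiableAt.differentiableWithinAt) fun y hy => ?_
    rw [interior_Ici] at hy
    refine (hd y).deriv.symm ▸ ?_
    nlinarith [hle y hy.le, Real.exp_pos y]
  have h1 := hanti2 Set.self_mem_Ici hx hx
  simp only at h1
  have h2 : Real.exp x * Real.exp (-x) = 1 := by rw [← Real.exp_add]; simp
  calc u x = u x * Real.exp x * Real.exp (-x) := by rw [mul_assoc, h2, mul_one]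
    _ ≤ _ := mul_le_mul_of_nonneg_right h1 (Real.exp_pos _).le

/-! ### Power series converging in the unit disc, uniformly in a parameter -/

/-- The power series with coefficients `c i`, `i ∈ s`, are bounded on every disc of radius less
than `1`, uniformly in `i`. -/
def UniformUnitRadius {ι : Type*} (s : Set ι) (c : ι → ℕ → ℝ) : Prop :=
  ∀ ρ : ℝ, 0 < ρ → ρ < 1 → ∃ C, ∀ i ∈ s, ∀ n, |c i n| * ρ ^ n ≤ C

/-- The sum of a power series. -/
noncomputable def powerSum (c : ℕ → ℝ) (z : ℝ) : ℝ := ∑' n, c n * z ^ n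

/-- The coefficients of the derivative of a power series. -/
def derivCoeff (c : ℕ → ℝ) (n : ℕ) : ℝ := ((n : ℝ) + 1) * c (n + 1)

namespace UniformUnitRadius

variable {ι : Type*} {s : Set ι} {c : ι → ℕ → ℝ}

theorem exists_summable_bound (h : UniformUnitRadius s c) {r : ℝ} (hr0 : 0 ≤ r) (hr1 : r < 1) :
    ∃ b : ℕ → ℝ, Summable b ∧ ∀ i ∈ s, ∀ n, ∀ z : ℝ, |z| ≤ r → ‖c i n * z ^ n‖ ≤ b n := by
  obtain ⟨C, hC⟩ := h ((1 + r) / 2) (by linarith) (by linarith)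
  set ρ := (1 + r) / 2 with hρ
  have hρ0 : 0 < ρ := by rw [hρ]; linarith
  refine ⟨fun n => C * (r / ρ) ^ n, (summable_geometric_of_lt_one (by positivity) ?_).mul_left C,
    fun i hi n z hz => ?_⟩
  · rw [div_lt_one hρ0, hρ]; linarith
  · rw [Real.norm_eq_abs, abs_mul, abs_pow]
    calc |c i n| * |z| ^ n ≤ |c i n| * r ^ n := by gcongr
      _ = (|c i n| * ρ ^ n) * (r / ρ) ^ n := by
        rw [div_pow r ρ, mul_assoc, mul_div_cancel₀ _ (pow_pos hρ0 n).ne']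
      _ ≤ C * (r / ρ) ^ n := by
        gcongr
        exact hC i hi n

theorem summable (h : UniformUnitRadius s c) {i : ι} (hi : i ∈ s) {z : ℝ} (hz : |z| < 1) :
    Summable fun n => c i n * z ^ n := by
  obtain ⟨b, hb, hle⟩ := h.exists_summable_bound (abs_nonneg z) hz
  exact Summable.of_norm_bounded hb fun n => hle i hi n z le_rfl

theorem hasSum (h : UniformUnitRadius s c) {i : ι} (hi : i ∈ s) {z : ℝ} (hz : |z| < 1) :
    HasSum (fun n => c i n * z ^ n) (powerSum (c i) z) :=
  (h.summable hi hz).hasSum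

/-- The factor `n + 1` is absorbed by passing from `ρ` to the larger radius `(1 + ρ) / 2`. Thus the
class is closed under differentiation. -/
theorem derivCoeff (h : UniformUnitRadius s c) :
    UniformUnitRadius s fun i => derivCoeff (c i) := fun ρ hρ0 hρ1 => by
  obtain ⟨C, hC⟩ := h ((1 + ρ) / 2) (by linarith) (by linarith)
  set σ := (1 + ρ) / 2 with hσ
  have hσ0 : 0 < σ := by rw [hσ]; linarith
  have hlt : ρ / σ < 1 := by rw [div_lt_one hσ0, hσ]; linarith
  have hb : Summable fun n : ℕ => ((n : ℝ) + 1) * (ρ / σ) ^ n := by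
    have h0 : ‖ρ / σ‖ < 1 := by rwa [Real.norm_of_nonneg (by positivity)]
    have h1 := summable_pow_mul_geometric_of_norm_lt_one 1 h0
    have h2 := summable_pow_mul_geometric_of_norm_lt_one 0 h0
    refine (h1.add h2).congr fun n => by simp; ring
  refine ⟨|C| / σ * ∑' n : ℕ, ((n : ℝ) + 1) * (ρ / σ) ^ n, fun i hi n => ?_⟩
  have h1 := hb.le_tsum n fun j _ => by positivity
  have h2 : |c i (n + 1)| * σ ^ (n + 1) ≤ |C| := (hC i hi (n + 1)).trans (le_abs_self C)
  have e : |_root_.derivCoeff (c i) n| * ρ ^ n =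
      (|c i (n + 1)| * σ ^ (n + 1)) / σ * (((n : ℝ) + 1) * (ρ / σ) ^ n) := by
    rw [_root_.derivCoeff, abs_mul, abs_of_nonneg (by positivity : (0 : ℝ) ≤ n + 1), div_pow ρ σ,
      pow_succ]
    field_simp
  rw [e]
  gcongr

theorem hasDerivAt (h : UniformUnitRadius s c) {i : ι} (hi : i ∈ s) {z : ℝ} (hz : |z| < 1) :
    HasDerivAt (powerSum (c i)) (powerSum (_root_.derivCoeff (c i)) z) z := by
  obtain ⟨r, hr, hr1⟩ := exists_between hz
  have hr0 : 0 ≤ r := (abs_nonneg z).trans hr.le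
  obtain ⟨b, hb, hle⟩ := h.derivCoeff.exists_summable_bound hr0 hr1
  -- Differentiation lowers the exponent, so the majorant of the derived series is shifted by one
  -- index; the constant term contributes `0`.
  set u : ℕ → ℝ := fun n => if n = 0 then 0 else b (n - 1) with hu
  have hus : Summable u := (summable_nat_add_iff 1).1 (by simpa [hu] using hb)
  have hd : ∀ n : ℕ, ∀ y ∈ Metric.ball (0 : ℝ) r, HasDerivAt (fun y => c i n * y ^ n)
      (c i n * (n * y ^ (n - 1))) y := fun n y _ => (hasDerivAt_pow n y).const_mul _
  have hbound : ∀ n : ℕ, ∀ y ∈ Metric.ball (0 : ℝ) r, ‖c i n * (n * y ^ (n - 1))‖ ≤ u n := by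
    rintro (_ | n) y hy
    · simp [hu]
    · have := hle i hi n y (by simpa using (mem_ball_zero_iff.1 hy).le)
      simp only [hu, Nat.add_sub_cancel, Nat.add_eq_zero_iff, one_ne_zero, and_false, if_false]
      convert this using 2
      rw [_root_.derivCoeff]; push_cast; ring
  have hzr : z ∈ Metric.ball (0 : ℝ) r := by simpa using hr
  have := hasDerivAt_tsum_of_isPreconnected hus Metric.isOpen_ball
    (convex_ball (0 : ℝ) r).isPreconnected hd hbound hzr (h.summable hi hz) hzr
  convert! this using 1
  rw [powerSum, (Summable.of_norm_bounded hus fun n => hbound n z hzr).tsum_eq_zero_add]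
  simp only [Nat.cast_zero, zero_mul, mul_zero, zero_add]
  refine tsum_congr fun n => ?_
  rw [_root_.derivCoeff]
  push_cast
  ring

theorem continuousOn [TopologicalSpace ι] (h : UniformUnitRadius s c)
    (hc : ∀ n, Continuous fun i => c i n) {r : ℝ} (hr0 : 0 ≤ r) (hr1 : r < 1) :
    ContinuousOn (fun x : ι × ℝ => powerSum (c x.1) x.2) (s ×ˢ {z | |z| ≤ r}) := by
  obtain ⟨b, hb, hle⟩ := h.exists_summable_bound hr0 hr1
  refine continuousOn_tsum (u := b) (fun n => ?_) hb fun n x hx => hle x.1 hx.1 n x.2 hx.2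
  exact (((hc n).comp continuous_fst).mul (continuous_snd.pow n)).continuousOn

end UniformUnitRadius

/-! ### Convergence of the Heun series and Heun's equation -/

/-- Second order recurrences whose coefficients tend to those with characteristic roots `1` and
`μ ∈ [0, 1]`, with error `O(1/n)`. -/
theorem uniformUnitRadius_of_recurrence {ι : Type*} {s : Set ι} {c a b : ι → ℕ → ℝ} {μ K : ℝ}
    (hμ0 : 0 ≤ μ) (hμ1 : μ ≤ 1) (hK : 0 < K)
    (hrec : ∀ i ∈ s, ∀ n, c i (n + 2) = a i n * c i (n + 1) - b i n * c i n)
    (ha : ∀ i ∈ s, ∀ n : ℕ, |a i n - (1 + μ)| ≤ K / (n + 1))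
    (hb : ∀ i ∈ s, ∀ n : ℕ, |b i n - μ| ≤ K / (n + 1))
    (h0 : ∀ i ∈ s, |c i 0| ≤ K) (h1 : ∀ i ∈ s, |c i 1| ≤ K) : UniformUnitRadius s c := by
  intro ρ hρ0 hρ1
  obtain ⟨θ, hθ0, hθ1, hθρ⟩ : ∃ θ : ℝ, 0 < θ ∧ θ ≤ 1 ∧ (1 + θ) * ρ < 1 := by
    refine ⟨(1 - ρ) / 2, by linarith, by linarith, by nlinarith⟩
  set f : ℕ → ℝ := fun n => 1 + θ + 2 * K / θ / (n + 1) with hf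
  have hfpos : ∀ n, 0 < f n := fun n => by simp only [hf]; positivity
  set B : ℕ → ℝ := fun n => 3 * K * ∏ j ∈ Finset.range n, f j with hB
  have hBpos : ∀ n, 0 < B n := fun n =>
    mul_pos (by linarith) (Finset.prod_pos fun j _ => hfpos j)
  have hBsucc : ∀ n, B (n + 1) = f n * B n := fun n => by
    simp only [hB, Finset.prod_range_succ]; ring
  have hsum : Summable fun n => B n * ρ ^ n := by
    refine summable_of_ratio_test_tendsto_lt_one (l := (1 + θ) * ρ) hθρ
      (Filter.Eventually.of_forall fun n => (mul_pos (hBpos n) (pow_pos hρ0 n)).ne') ?_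
    have e : (fun n => ‖B (n + 1) * ρ ^ (n + 1)‖ / ‖B n * ρ ^ n‖) = fun n => f n * ρ := by
      funext n
      have h2 := hBpos n
      have h3 := pow_pos hρ0 n
      rw [Real.norm_of_nonneg (mul_pos (hBpos _) (pow_pos hρ0 _)).le,
        Real.norm_of_nonneg (mul_pos h2 h3).le, hBsucc, pow_succ]
      field_simp
    rw [e]
    refine Filter.Tendsto.mul_const ρ ?_
    have h4 : Filter.Tendsto (fun n : ℕ => 2 * K / θ * (1 / ((n : ℝ) + 1))) Filter.atTop
        (nhds (2 * K / θ * 0)) := tendsto_one_div_add_atTop_nhds_zero_nat.const_mul _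
    have h5 := h4.const_add (1 + θ)
    simp only [mul_zero, add_zero] at h5
    refine h5.congr fun n => ?_
    simp only [hf]; ring
  -- Subtracting `μ c n` splits off one root: the difference then evolves with the other root `1`.
  -- With weight `θ` on `|c n|` the limiting recurrence has norm at most `1 + θ`, even for the
  -- double root `μ = 1`. The `O(1/n)` errors give the last summand of `f`, and `3K` covers the
  -- initial data.
  have hmaj : ∀ i ∈ s, ∀ n, |c i (n + 1) - μ * c i n| + θ * |c i n| ≤ B n := by
    intro i hi n
    induction n with
    | zero =>
      have h2 : |c i 1 - μ * c i 0| ≤ |c i 1| + |μ * c i 0| := abs_sub _ _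
      rw [abs_mul, abs_of_nonneg hμ0] at h2
      have h3 := h0 i hi
      have h4 := h1 i hi
      have h5 := abs_nonneg (c i 0)
      simp only [hB, Finset.range_zero, Finset.prod_empty, zero_add]
      nlinarith
    | succ n ih =>
      set d := c i (n + 1) - μ * c i n with hd
      have hc1 : c i (n + 1) = d + μ * c i n := by rw [hd]; ring
      have h2 : |c i (n + 1)| ≤ |d| + |c i n| := by
        rw [hc1]
        refine (abs_add_le _ _).trans ?_
        rw [abs_mul, abs_of_nonneg hμ0]
        nlinarith [abs_nonneg (c i n)]
      have e : c i (n + 1 + 1) - μ * c i (n + 1) =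
          d + ((a i n - (1 + μ)) * c i (n + 1) - (b i n - μ) * c i n) := by
        rw [hrec i hi n, hd]; ring
      have hKn : 0 ≤ K / ((n : ℝ) + 1) := by positivity
      have h3 : |c i (n + 1 + 1) - μ * c i (n + 1)| ≤
          |d| + K / (n + 1) * (|d| + 2 * |c i n|) := by
        rw [e]
        refine (abs_add_le _ _).trans ?_
        gcongr
        refine (abs_sub _ _).trans ?_
        rw [abs_mul, abs_mul]
        have h4 := mul_le_mul (ha i hi n) h2 (abs_nonneg _) hKn
        have h5 := mul_le_mul_of_nonneg_right (hb i hi n) (abs_nonneg (c i n))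
        linarith
      have h6 : |d| + 2 * |c i n| ≤ 2 / θ * (|d| + θ * |c i n|) := by
        have h7 : 2 / θ * (|d| + θ * |c i n|) = 2 / θ * |d| + 2 * |c i n| := by field_simp
        have h8 : 1 ≤ 2 / θ := by rw [le_div_iff₀ hθ0]; linarith
        rw [h7]
        nlinarith [abs_nonneg d]
      rw [hBsucc]
      calc _ ≤ |d| + K / (n + 1) * (2 / θ * (|d| + θ * |c i n|)) + θ * (|d| + |c i n|) := by
            have h9 := mul_le_mul_of_nonneg_left h6 hKn
            have h10 := mul_le_mul_of_nonneg_left h2 hθ0.le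
            linarith
        _ ≤ f n * (|d| + θ * |c i n|) := by
            have : f n * (|d| + θ * |c i n|) = (1 + θ) * (|d| + θ * |c i n|) +
              K / (n + 1) * (2 / θ * (|d| + θ * |c i n|)) := by simp only [hf]; ring
            rw [this]
            nlinarith [abs_nonneg (c i n), mul_nonneg (mul_self_nonneg θ) (abs_nonneg (c i n))]
        _ ≤ f n * B n := mul_le_mul_of_nonneg_left ih (hfpos n).le
  refine ⟨(∑' n, B n * ρ ^ n) / θ, fun i hi n => ?_⟩
  have h2 := hsum.le_tsum n fun j _ => (mul_pos (hBpos j) (pow_pos hρ0 j)).le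
  have h3 : θ * |c i n| ≤ B n := by linarith [hmaj i hi n, abs_nonneg (c i (n + 1) - μ * c i n)]
  rw [le_div_iff₀ hθ0]
  nlinarith [mul_le_mul_of_nonneg_right h3 (pow_pos hρ0 n).le]

/-- The local Heun series with `p ≥ 1` have radius of convergence at least `1`, locally uniformly in
the parameters. -/
theorem uniformUnitRadius_heunCoeff {ι : Type*} {s : Set ι} {p γ R : ℝ} {q α β δ : ι → ℝ}
    (hp : 1 ≤ p) (hγ : 0 < γ) (hq : ∀ i ∈ s, |q i| ≤ R) (hα : ∀ i ∈ s, |α i| ≤ R)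
    (hβ : ∀ i ∈ s, |β i| ≤ R) (hδ : ∀ i ∈ s, |δ i| ≤ R) :
    UniformUnitRadius s fun i => heunCoeff p (q i) (α i) (β i) γ (δ i) := by
  rcases s.eq_empty_or_nonempty with rfl | ⟨i₀, hi₀⟩
  · exact fun ρ _ _ => ⟨0, fun i hi => hi.elim⟩
  have hR : 0 ≤ R := (abs_nonneg _).trans (hq i₀ hi₀)
  have hp0 : 0 < p := by linarith
  set K₁ := (1 + p) * (2 + γ) + p * R + (3 * R + γ + 1) + R with hK₁
  set K₂ := 2 * R + R ^ 2 + 5 + 3 * γ with hK₂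
  have hK₁0 : 0 ≤ K₁ := by positivity
  have hK₂0 : 0 ≤ K₂ := by positivity
  have hRγ : 0 ≤ R / γ := by positivity
  set K := K₁ + K₂ + R / γ + 1 with hK
  -- After subtraction of the limits the numerators are only linear in `n`, while the denominator is
  -- at least `(n + 1)²`.
  have hquot : ∀ (n : ℕ) (M L : ℝ), 0 ≤ L → L ≤ K → |M| ≤ (n + 1) * L →
      |M / (p * ((n : ℝ) + 2) * ((n : ℝ) + 1 + γ))| ≤ K / (n + 1) := fun n M L hL hLK hM => by
    have hn : (0 : ℝ) < n + 1 := by positivity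
    have hden : ((n : ℝ) + 1) * (n + 1) ≤ p * ((n : ℝ) + 2) * ((n : ℝ) + 1 + γ) := by
      have : (n : ℝ) + 1 ≤ p * (n + 2) := by nlinarith
      exact mul_le_mul this (by linarith) hn.le (by positivity)
    rw [abs_div, abs_of_pos (by positivity : 0 < p * ((n : ℝ) + 2) * ((n : ℝ) + 1 + γ))]
    calc _ ≤ ((n : ℝ) + 1) * L / (((n : ℝ) + 1) * (n + 1)) := by gcongr
      _ = L / (n + 1) := by field_simp
      _ ≤ _ := by gcongr
  refine uniformUnitRadius_of_recurrence (μ := 1 / p) (K := K)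
    (a := fun i n => (((n : ℝ) + 1) * (((n : ℝ) + γ) * (1 + p) + p * δ i +
      (α i + β i - γ - δ i + 1)) + q i) / (p * ((n : ℝ) + 2) * ((n : ℝ) + 1 + γ)))
    (b := fun i n => ((n : ℝ) + α i) * ((n : ℝ) + β i) / (p * ((n : ℝ) + 2) * ((n : ℝ) + 1 + γ)))
    (by positivity) ((div_le_one hp0).2 hp) (by positivity) (fun i hi n => ?_) (fun i hi n => ?_)
    (fun i hi n => ?_) (fun i hi => ?_) (fun i hi => ?_)
  · simp only [heunCoeff]; ring
  · have e : (((n : ℝ) + 1) * (((n : ℝ) + γ) * (1 + p) + p * δ i +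
        (α i + β i - γ - δ i + 1)) + q i) / (p * ((n : ℝ) + 2) * ((n : ℝ) + 1 + γ)) -
        (1 + 1 / p) = (-((1 + p) * (2 * n + 2 + γ)) + ((n : ℝ) + 1) *
        (p * δ i + (α i + β i - γ - δ i + 1)) + q i) /
        (p * ((n : ℝ) + 2) * ((n : ℝ) + 1 + γ)) := by
      have : (n : ℝ) + 1 + γ ≠ 0 := by positivity
      field_simp
      ring
    simp only [e]
    refine hquot n _ K₁ hK₁0 (by rw [hK]; linarith) ?_
    have hn : (0 : ℝ) ≤ n := by positivity
    obtain ⟨q1, q2⟩ := abs_le.1 (hq i hi)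
    obtain ⟨a1, a2⟩ := abs_le.1 (hα i hi)
    obtain ⟨b1, b2⟩ := abs_le.1 (hβ i hi)
    obtain ⟨d1, d2⟩ := abs_le.1 (hδ i hi)
    have hpd : |p * δ i + (α i + β i - γ - δ i + 1)| ≤ p * R + (3 * R + γ + 1) :=
      abs_le.2 ⟨by nlinarith, by nlinarith⟩
    have t1 : |-((1 + p) * (2 * n + 2 + γ))| ≤ (n + 1) * ((1 + p) * (2 + γ)) := by
      rw [abs_neg, abs_of_nonneg (by positivity)]
      have : 2 * (n : ℝ) + 2 + γ ≤ (n + 1) * (2 + γ) := by nlinarith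
      nlinarith
    have t2 : |((n : ℝ) + 1) * (p * δ i + (α i + β i - γ - δ i + 1))| ≤
        (n + 1) * (p * R + (3 * R + γ + 1)) := by
      rw [abs_mul, abs_of_nonneg (by positivity : (0 : ℝ) ≤ n + 1)]
      gcongr
    have t3 : |q i| ≤ (n + 1) * R := (hq i hi).trans (by nlinarith)
    calc _ ≤ _ := abs_add_three _ _ _
      _ ≤ (n + 1) * ((1 + p) * (2 + γ)) + (n + 1) * (p * R + (3 * R + γ + 1)) + (n + 1) * R := by
        gcongr
      _ = _ := by rw [hK₁]; ring
  · have e : ((n : ℝ) + α i) * ((n : ℝ) + β i) / (p * ((n : ℝ) + 2) * ((n : ℝ) + 1 + γ)) - 1 / p =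
        (n * (α i + β i - 3 - γ) + (α i * β i - 2 - 2 * γ)) /
        (p * ((n : ℝ) + 2) * ((n : ℝ) + 1 + γ)) := by
      have : (n : ℝ) + 1 + γ ≠ 0 := by positivity
      field_simp
      ring
    simp only [e]
    refine hquot n _ K₂ hK₂0 (by rw [hK]; linarith) ?_
    have hn : (0 : ℝ) ≤ n := by positivity
    obtain ⟨a1, a2⟩ := abs_le.1 (hα i hi)
    obtain ⟨b1, b2⟩ := abs_le.1 (hβ i hi)
    have hab : |α i * β i| ≤ R ^ 2 := by
      rw [abs_mul, sq]; exact mul_le_mul (hα i hi) (hβ i hi) (abs_nonneg _) hR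
    obtain ⟨ab1, ab2⟩ := abs_le.1 hab
    have t1 : |(n : ℝ) * (α i + β i - 3 - γ)| ≤ n * (2 * R + 3 + γ) := by
      rw [abs_mul, abs_of_nonneg hn]
      gcongr
      exact abs_le.2 ⟨by linarith, by linarith⟩
    have t2 : |α i * β i - 2 - 2 * γ| ≤ R ^ 2 + 2 + 2 * γ := abs_le.2 ⟨by linarith, by linarith⟩
    refine (abs_add_le _ _).trans ((add_le_add t1 t2).trans ?_)
    rw [hK₂]
    have : 0 ≤ (n : ℝ) * (R ^ 2 + 2 + 2 * γ) := by positivity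
    nlinarith
  · simp only [heunCoeff, abs_one]
    linarith
  · simp only [heunCoeff]
    rw [abs_div, abs_of_pos (by positivity : 0 < p * γ)]
    have : |q i| / (p * γ) ≤ R / γ := by
      have := hq i hi
      have h3 : γ ≤ p * γ := by nlinarith
      gcongr
    linarith

/-- The local Heun function solves Heun's equation. -/
theorem powerSum_heunCoeff_ode {p q α β γ δ z : ℝ} (hp : p ≠ 0) (hγ : 0 < γ)
    (h0 : Summable fun n => heunCoeff p q α β γ δ n * z ^ n)
    (h1 : Summable fun n => derivCoeff (heunCoeff p q α β γ δ) n * z ^ n)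
    (h2 : Summable fun n => derivCoeff (derivCoeff (heunCoeff p q α β γ δ)) n * z ^ n) :
    z * (z - 1) * (z - p) * powerSum (derivCoeff (derivCoeff (heunCoeff p q α β γ δ))) z +
      (γ * (z - 1) * (z - p) + δ * z * (z - p) + (α + β - γ - δ + 1) * z * (z - 1)) *
        powerSum (derivCoeff (heunCoeff p q α β γ δ)) z +
      (α * β * z - q) * powerSum (heunCoeff p q α β γ δ) z = 0 := by
  set c := heunCoeff p q α β γ δ with hc
  have S0 : HasSum (fun n => c n * z ^ n) (powerSum c z) := h0.hasSum
  have S1 : HasSum (fun n => derivCoeff c n * z ^ n) (powerSum (derivCoeff c) z) := h1.hasSum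
  have S2 : HasSum (fun n => derivCoeff (derivCoeff c) n * z ^ n)
    (powerSum (derivCoeff (derivCoeff c)) z) := h2.hasSum
  set f0 := powerSum c z
  set f1 := powerSum (derivCoeff c) z
  set f2 := powerSum (derivCoeff (derivCoeff c)) z
  have S0' := (hasSum_nat_add_iff' 1).2 S0
  have S1' := (hasSum_nat_add_iff' 1).2 S1
  have T1 : HasSum (fun n : ℕ => n * c n * z ^ n) (z * f1) := by
    refine (hasSum_nat_add_iff' 1).1 ?_
    simp only [Finset.range_one, Finset.sum_singleton, Nat.cast_zero, zero_mul, sub_zero]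
    refine (S1.mul_left z).congr_fun fun n => ?_
    simp only [derivCoeff]; push_cast; ring
  have T2 : HasSum (fun n : ℕ => n * derivCoeff c n * z ^ n) (z * f2) := by
    refine (hasSum_nat_add_iff' 1).1 ?_
    simp only [Finset.range_one, Finset.sum_singleton, Nat.cast_zero, zero_mul, sub_zero]
    refine (S2.mul_left z).congr_fun fun n => ?_
    simp only [derivCoeff]; push_cast; ring
  have T3 : HasSum (fun n : ℕ => n * (n - 1) * c n * z ^ n) (z * (z * f2)) := by
    refine (hasSum_nat_add_iff' 1).1 ?_
    simp only [Finset.range_one, Finset.sum_singleton, Nat.cast_zero, zero_mul, sub_zero]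
    refine (T2.mul_left z).congr_fun fun n => ?_
    simp only [derivCoeff]; push_cast; ring
  simp only [Finset.range_one, Finset.sum_singleton, pow_zero, mul_one] at S0' S1'
  -- All series are aligned at `z ^ (n + 1)`, with `S0'` and `S1'` lacking their constant terms. The
  -- combination vanishes termwise by the recurrence; the removed constants cancel because `p γ c₁ =
  -- q c₀`.
  have hall := (((T3.add (T1.mul_left (α + β + 1))).add (S0.mul_left (α * β))).mul_left z).sub
    (((T2.mul_left (1 + p)).mul_left z).add
      ((S1.mul_left (z * (γ * (1 + p) + p * δ + (α + β - γ - δ + 1)))).add (S0'.mul_left q)))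
  have hall2 := hall.add (((S2.mul_left z).add (S1'.mul_left γ)).mul_left p)
  have hterm : ∀ n : ℕ, p * ((n : ℝ) + 2) * ((n : ℝ) + 1 + γ) * c (n + 2) =
      (((n : ℝ) + 1) * (((n : ℝ) + γ) * (1 + p) + p * δ + (α + β - γ - δ + 1)) + q) * c (n + 1) -
        ((n : ℝ) + α) * ((n : ℝ) + β) * c n := fun n => by
    have : (n : ℝ) + 1 + γ ≠ 0 := by positivity
    have : (n : ℝ) + 2 ≠ 0 := by positivity
    rw [hc, heunCoeff.eq_3]
    field_simp
  have hzero := hall2.unique (hasSum_zero.congr_fun fun n => ?_)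
  · have e0 : c 0 = 1 := rfl
    have e1 : derivCoeff c 0 = q / (p * γ) := by simp [derivCoeff, hc, heunCoeff]
    have e2 : p * (γ * (q / (p * γ))) = q := by field_simp
    rw [e0, e1] at hzero
    linear_combination hzero + e2
  · simp only [derivCoeff]
    push_cast
    linear_combination z ^ (n + 1) * hterm n

/-! ### The even solution in the variable `tanh` -/

/-- The coefficients of the Heun series in the bound state, as a function of `k = √(4 - lam)`. -/
noncomputable def modeCoeff (a k : ℝ) : ℕ → ℝ :=
  heunCoeff (1 - heunP a)
    ((k / 2 + 3) * ((k + 7) / 2) -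
      (6 * Real.cosh (2 * a) * (k + 3) - (k + 6) * (k + 1)) / (4 * Real.sinh a ^ 2))
    (k / 2 + 3) ((k + 7) / 2) heunDelta (k + 1)

/-- The even solution with decay parameter `k`, in terms of `tanh`. -/
noncomputable def lumpMode (a k x : ℝ) : ℝ :=
  (1 / Real.cosh x) ^ k * (Real.sinh a ^ 2 * (1 - Real.tanh x ^ 2) + 1) ^ 3 *
    powerSum (modeCoeff a k) (Real.tanh x ^ 2)

/-- The derivative of `lumpMode`. -/
noncomputable def lumpModeDeriv (a k x : ℝ) : ℝ :=
  (1 / Real.cosh x) ^ k * (Real.tanh x *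
    (-k * (Real.sinh a ^ 2 * (1 - Real.tanh x ^ 2) + 1) ^ 3 *
        powerSum (modeCoeff a k) (Real.tanh x ^ 2) +
      2 * (1 - Real.tanh x ^ 2) *
        ((Real.sinh a ^ 2 * (1 - Real.tanh x ^ 2) + 1) ^ 3 *
            powerSum (derivCoeff (modeCoeff a k)) (Real.tanh x ^ 2) -
          3 * Real.sinh a ^ 2 * (Real.sinh a ^ 2 * (1 - Real.tanh x ^ 2) + 1) ^ 2 *
            powerSum (modeCoeff a k) (Real.tanh x ^ 2))))

theorem one_div_cosh_sq (x : ℝ) : (1 / Real.cosh x) ^ 2 = 1 - Real.tanh x ^ 2 := by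
  have := Real.cosh_sq x
  have h := (Real.cosh_pos x).ne'
  rw [Real.tanh_eq_sinh_div_cosh]
  field_simp
  linarith

theorem tanh_sq_lt_one (x : ℝ) : Real.tanh x ^ 2 < 1 := by
  have := one_div_cosh_sq x
  have h := Real.cosh_pos x
  have : 0 < (1 / Real.cosh x) ^ 2 := by positivity
  linarith

theorem abs_tanh_sq_lt_one (x : ℝ) : |Real.tanh x ^ 2| < 1 := by
  rw [abs_of_nonneg (sq_nonneg _)]; exact tanh_sq_lt_one x

theorem heunMode_eq_lumpMode (a lam x : ℝ) :
    heunMode a lam x = lumpMode a (Real.sqrt (4 - lam)) x := by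
  rw [lumpMode, ← one_div_cosh_sq]
  rfl

theorem hasDerivAt_tanh (x : ℝ) : HasDerivAt Real.tanh (1 - Real.tanh x ^ 2) x := by
  have e : Real.tanh = fun x => Real.sinh x / Real.cosh x :=
    funext Real.tanh_eq_sinh_div_cosh
  rw [e]
  refine ((Real.hasDerivAt_sinh x).div (Real.hasDerivAt_cosh x)
    (Real.cosh_pos x).ne').congr_deriv ?_
  have h := (Real.cosh_pos x).ne'
  field_simp

theorem continuous_tanh : Continuous Real.tanh :=
  continuous_iff_continuousAt.2 fun x => (hasDerivAt_tanh x).continuousAt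

theorem hasDerivAt_sech_rpow (k x : ℝ) : HasDerivAt (fun x => (1 / Real.cosh x) ^ k)
    (-(k * Real.tanh x * (1 / Real.cosh x) ^ k)) x := by
  have hc := Real.cosh_pos x
  have h1 : HasDerivAt (fun x => 1 / Real.cosh x) (-(Real.tanh x * (1 / Real.cosh x))) x := by
    refine ((hasDerivAt_const x (1 : ℝ)).div (Real.hasDerivAt_cosh x) hc.ne').congr_deriv ?_
    rw [Real.tanh_eq_sinh_div_cosh]
    field_simp
    ring
  have hpos : 0 < 1 / Real.cosh x := by positivity
  refine (h1.rpow_const (p := k) (Or.inl hpos.ne')).congr_deriv ?_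
  rw [Real.rpow_sub_one hpos.ne']
  field_simp

theorem continuous_modeCoeff (a : ℝ) (n : ℕ) : Continuous fun k => modeCoeff a k n := by
  suffices h : ∀ n, (Continuous fun k => modeCoeff a k n) ∧
    Continuous fun k => modeCoeff a k (n + 1) from (h n).1
  intro n
  induction n with
  | zero =>
    simp only [modeCoeff, heunCoeff]
    exact ⟨continuous_const, by fun_prop⟩
  | succ n ih =>
    refine ⟨ih.2, ?_⟩
    have h0 := ih.1
    have h1 := ih.2
    simp only [modeCoeff] at h0 h1
    simp only [modeCoeff, heunCoeff]
    fun_prop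

theorem one_le_one_sub_heunP (a : ℝ) : 1 ≤ 1 - heunP a := by
  have : 0 ≤ 1 / Real.sinh a ^ 2 := by positivity
  rw [heunP, neg_div]
  linarith

theorem uniformUnitRadius_modeCoeff (a L : ℝ) :
    UniformUnitRadius (Set.Icc 0 L) (modeCoeff a) := by
  set q : ℝ → ℝ := fun k => (k / 2 + 3) * ((k + 7) / 2) -
      (6 * Real.cosh (2 * a) * (k + 3) - (k + 6) * (k + 1)) / (4 * Real.sinh a ^ 2) with hq
  have hcont : Continuous fun k : ℝ => |q k| + |k / 2 + 3| + |(k + 7) / 2| + |k + 1| := by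
    simp only [hq]; fun_prop
  obtain ⟨R, hR⟩ := (isCompact_Icc (a := (0 : ℝ)) (b := L)).exists_bound_of_continuousOn
    hcont.continuousOn
  have hle : ∀ k ∈ Set.Icc 0 L, |q k| + |k / 2 + 3| + |(k + 7) / 2| + |k + 1| ≤ R :=
    fun k hk => (le_abs_self _).trans (hR k hk)
  refine uniformUnitRadius_heunCoeff (R := R) (one_le_one_sub_heunP a)
    (by norm_num [heunDelta]) (fun k hk => ?_) (fun k hk => ?_) (fun k hk => ?_) fun k hk => ?_
  all_goals
    have h := hle k hk
    have h1 := abs_nonneg (q k)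
    have h2 := abs_nonneg (k / 2 + 3)
    have h3 := abs_nonneg ((k + 7) / 2)
    have h4 := abs_nonneg (k + 1)
    simp only [hq] at h h1 ⊢
    linarith

/-- The factor `sinh² a sech² x + 1` equals `(cosh 2x + cosh 2a) / (2 cosh² x)`, so its square
clears the denominator of the potential. -/
theorem lumpPotential_mul_sq (a x : ℝ) :
    lumpPotential a x * (Real.sinh a ^ 2 * (1 - Real.tanh x ^ 2) + 1) ^ 2 =
      4 * (Real.sinh a ^ 2 * (1 - Real.tanh x ^ 2) + 1) ^ 2 -
        12 * (1 + Real.sinh a ^ 2 * (1 + Real.tanh x ^ 2)) * (1 - Real.tanh x ^ 2) := by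
  have hc := Real.cosh_pos x
  have hW : Real.sinh a ^ 2 * (1 - Real.tanh x ^ 2) + 1 =
      (Real.cosh (2 * x) + Real.cosh (2 * a)) / (2 * Real.cosh x ^ 2) := by
    rw [← one_div_cosh_sq, Real.cosh_two_mul, Real.cosh_two_mul, Real.sinh_sq x, Real.cosh_sq a]
    field_simp
    ring
  have hN : (1 + Real.sinh a ^ 2 * (1 + Real.tanh x ^ 2)) =
      (1 + Real.cosh (2 * x) * Real.cosh (2 * a)) / (2 * Real.cosh x ^ 2) := by
    rw [Real.tanh_eq_sinh_div_cosh, Real.cosh_two_mul, Real.cosh_two_mul, div_pow,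
      Real.sinh_sq x, Real.cosh_sq a]
    field_simp
    ring
  have hS : 0 < Real.cosh (2 * x) + Real.cosh (2 * a) :=
    add_pos (Real.cosh_pos _) (Real.cosh_pos _)
  rw [hW, hN, ← one_div_cosh_sq, lumpPotential]
  field_simp
  ring

section ODE

variable {a k : ℝ}

theorem hasDerivAt_powerSum_tanh_sq {c : ℝ → ℕ → ℝ} {L : ℝ}
    (h : UniformUnitRadius (Set.Icc 0 L) c) (hk : k ∈ Set.Icc 0 L) (x : ℝ) :
    HasDerivAt (fun x => powerSum (c k) (Real.tanh x ^ 2))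
      (powerSum (derivCoeff (c k)) (Real.tanh x ^ 2) *
        (2 * Real.tanh x * (1 - Real.tanh x ^ 2))) x :=
  HasDerivAt.comp x (h.hasDerivAt hk (abs_tanh_sq_lt_one x))
    (((hasDerivAt_tanh x).pow 2).congr_deriv (by norm_num))

theorem hasDerivAt_lumpMode (hk : 0 ≤ k) (x : ℝ) :
    HasDerivAt (lumpMode a k) (lumpModeDeriv a k x) x := by
  have hu := uniformUnitRadius_modeCoeff a k
  have hf := hasDerivAt_powerSum_tanh_sq hu ⟨hk, le_rfl⟩ x
  have hC := hasDerivAt_sech_rpow k x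
  have hW := (((((hasDerivAt_tanh x).pow 2).const_sub 1).const_mul (Real.sinh a ^ 2)).add_const
    1).pow 3
  refine ((hC.mul hW).mul hf).congr_deriv ?_
  simp only [lumpModeDeriv, Pi.mul_apply, Pi.pow_apply]
  push_cast
  ring

/-- This is Heun's equation at `z = tanh² x` multiplied by `sinh² a`, which turns the factor `z - (1
- p)` into minus the factor cubed in the mode. -/
theorem modeCoeff_ode (ha : a ≠ 0) (hk : 0 ≤ k) (x : ℝ) :
    Real.tanh x ^ 2 * (1 - Real.tanh x ^ 2) * (Real.sinh a ^ 2 * (1 - Real.tanh x ^ 2) + 1) *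
        powerSum (derivCoeff (derivCoeff (modeCoeff a k))) (Real.tanh x ^ 2) +
      (1 / 2 * (1 - Real.tanh x ^ 2) * (Real.sinh a ^ 2 * (1 - Real.tanh x ^ 2) + 1) -
          (k + 1) * Real.tanh x ^ 2 * (Real.sinh a ^ 2 * (1 - Real.tanh x ^ 2) + 1) -
          6 * Real.sinh a ^ 2 * Real.tanh x ^ 2 * (1 - Real.tanh x ^ 2)) *
        powerSum (derivCoeff (modeCoeff a k)) (Real.tanh x ^ 2) +
      (-((k / 2 + 3) * ((k + 7) / 2) * (1 - Real.tanh x ^ 2) * Real.sinh a ^ 2) +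
          (6 * (1 + 2 * Real.sinh a ^ 2) * (k + 3) - (k + 6) * (k + 1)) / 4) *
        powerSum (modeCoeff a k) (Real.tanh x ^ 2) = 0 := by
  have hu := uniformUnitRadius_modeCoeff a k
  have hmem : k ∈ Set.Icc 0 k := ⟨hk, le_rfl⟩
  have hz := abs_tanh_sq_lt_one x
  have hs : Real.sinh a ≠ 0 := by rwa [ne_eq, Real.sinh_eq_zero]
  have h := powerSum_heunCoeff_ode (by linarith [one_le_one_sub_heunP a] : (1 - heunP a) ≠ 0)
    (by norm_num [heunDelta]) (hu.summable hmem hz) (hu.derivCoeff.summable hmem hz)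
    (hu.derivCoeff.derivCoeff.summable hmem hz)
  change _ * powerSum (derivCoeff (derivCoeff (modeCoeff a k))) _ +
    _ * powerSum (derivCoeff (modeCoeff a k)) _ + _ * powerSum (modeCoeff a k) _ = 0 at h
  rw [Real.cosh_two_mul, Real.cosh_sq] at h
  simp only [heunP, heunDelta] at h
  field_simp at h
  linear_combination h / 16

theorem hasDerivAt_lumpModeDeriv (ha : a ≠ 0) (hk : 0 ≤ k) (x : ℝ) :
    HasDerivAt (lumpModeDeriv a k) ((lumpPotential a x - (4 - k ^ 2)) * lumpMode a k x) x := by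
  have hu := uniformUnitRadius_modeCoeff a k
  have hf := hasDerivAt_powerSum_tanh_sq hu ⟨hk, le_rfl⟩ x
  have hf₁ := hasDerivAt_powerSum_tanh_sq hu.derivCoeff ⟨hk, le_rfl⟩ x
  have hC := hasDerivAt_sech_rpow k x
  have hT := hasDerivAt_tanh x
  have hD := (hT.pow 2).const_sub 1
  have hW := (hD.const_mul (Real.sinh a ^ 2)).add_const 1
  have h := hC.mul (hT.mul ((((hW.pow 3).const_mul (-k)).mul hf).add
    ((hD.const_mul 2).mul (((hW.pow 3).mul hf₁).sub
      (((hW.pow 2).const_mul (3 * Real.sinh a ^ 2)).mul hf)))))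
  refine h.congr_deriv ?_
  have hU := lumpPotential_mul_sq a x
  have hode := modeCoeff_ode ha hk x
  simp only [lumpMode, Pi.mul_apply, Pi.pow_apply, Pi.add_apply, Pi.sub_apply]
  push_cast
  set C := (1 / Real.cosh x) ^ k
  set t := Real.tanh x
  set f := powerSum (modeCoeff a k) (t ^ 2)
  set f₁ := powerSum (derivCoeff (modeCoeff a k)) (t ^ 2)
  set f₂ := powerSum (derivCoeff (derivCoeff (modeCoeff a k))) (t ^ 2)
  set s := Real.sinh a
  linear_combination 4 * C * (1 - t ^ 2) * (s ^ 2 * (1 - t ^ 2) + 1) ^ 2 * hode -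
    C * (s ^ 2 * (1 - t ^ 2) + 1) * f * hU

end ODE

/-! ### Joint continuity in the spectral parameter and the position -/

theorem continuous_powerSum_tanh_sq {c : ℝ → ℕ → ℝ}
    (hu : ∀ L, UniformUnitRadius (Set.Icc 0 L) c) (hc : ∀ n, Continuous fun k => c k n) :
    Continuous fun p : ℝ × ℝ => powerSum (c (Real.sqrt (4 - p.1))) (Real.tanh p.2 ^ 2) := by
  refine continuous_iff_continuousAt.2 fun p => ?_
  -- The added `1`, and `r` strictly between `tanh²` and `1`, make the region of uniform convergence
  -- a neighbourhood of the point.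
  set L := Real.sqrt (4 - p.1) + 1 with hL
  obtain ⟨r, hr, hr1⟩ := exists_between (tanh_sq_lt_one p.2)
  have hr0 : 0 ≤ r := (sq_nonneg _).trans hr.le
  have hG : Continuous fun p : ℝ × ℝ => (Real.sqrt (4 - p.1), Real.tanh p.2 ^ 2) := by
    have := continuous_tanh
    fun_prop
  have hs := (hu L).continuousOn hc hr0 hr1
  have h := hs.comp hG.continuousOn fun p hp => hp
  refine h.continuousAt ?_
  have ho : IsOpen ((fun p : ℝ × ℝ => (Real.sqrt (4 - p.1), Real.tanh p.2 ^ 2)) ⁻¹'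
      (Set.Iio L ×ˢ Set.Iio r)) := (isOpen_Iio.prod isOpen_Iio).preimage hG
  refine Filter.mem_of_superset (ho.mem_nhds ⟨?_, hr⟩) fun y hy => ?_
  · simp [hL]
  · refine ⟨⟨Real.sqrt_nonneg _, hy.1.le⟩, ?_⟩
    have : Real.tanh y.2 ^ 2 < r := hy.2
    simpa using this.le

theorem continuous_sech_rpow : Continuous fun p : ℝ × ℝ =>
    (1 / Real.cosh p.2) ^ Real.sqrt (4 - p.1) := by
  refine Continuous.rpow ?_ (by fun_prop) fun p => Or.inl (by
    have := Real.cosh_pos p.2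
    positivity)
  exact continuous_const.div (Real.continuous_cosh.comp continuous_snd) fun p =>
    (Real.cosh_pos p.2).ne'

theorem continuous_lumpMode (a : ℝ) :
    Continuous fun p : ℝ × ℝ => lumpMode a (Real.sqrt (4 - p.1)) p.2 := by
  have h0 := continuous_powerSum_tanh_sq (fun L => uniformUnitRadius_modeCoeff a L)
    (continuous_modeCoeff a)
  have := continuous_sech_rpow
  have := continuous_tanh
  simp only [lumpMode]
  fun_prop

theorem continuous_lumpModeDeriv (a : ℝ) :
    Continuous fun p : ℝ × ℝ => lumpModeDeriv a (Real.sqrt (4 - p.1)) p.2 := by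
  have h0 := continuous_powerSum_tanh_sq (fun L => uniformUnitRadius_modeCoeff a L)
    (continuous_modeCoeff a)
  have h1 := continuous_powerSum_tanh_sq
    (fun L => (uniformUnitRadius_modeCoeff a L).derivCoeff)
    (fun n => continuous_const.mul (continuous_modeCoeff a (n + 1)))
  have := continuous_sech_rpow
  have := continuous_tanh
  simp only [lumpModeDeriv]
  fun_prop

theorem lumpMode_neg (a k x : ℝ) : lumpMode a k (-x) = lumpMode a k x := by
  simp [lumpMode, Real.tanh_neg, Real.cosh_neg]

theorem lumpMode_zero_pos (a k : ℝ) : 0 < lumpMode a k 0 := by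
  have h : powerSum (modeCoeff a k) 0 = 1 := by
    rw [powerSum, tsum_eq_single 0 fun n hn => by simp [hn]]
    simp [modeCoeff, heunCoeff]
  simp only [lumpMode, Real.tanh_zero, Real.cosh_zero, ne_eq, OfNat.ofNat_ne_zero,
    not_false_eq_true, zero_pow, h, div_one, Real.one_rpow, one_mul, mul_one]
  positivity

theorem lumpModeDeriv_zero (a k : ℝ) : lumpModeDeriv a k 0 = 0 := by
  simp [lumpModeDeriv]

open Filter Topology in
theorem integrable_of_even_of_le_exp {f : ℝ → ℝ} (hf : Continuous f) (heven : ∀ x, f (-x) = f x)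
    {C X : ℝ} (hle : ∀ x, X ≤ x → |f x| ≤ C * Real.exp (-x)) : MeasureTheory.Integrable f := by
  have h1 : MeasureTheory.IntegrableOn f (Set.Ioi 0) := by
    refine integrable_of_isBigO_exp_neg one_pos hf.continuousOn ?_
    refine Asymptotics.IsBigO.of_bound C ?_
    filter_upwards [eventually_ge_atTop X] with x hx
    simpa [Real.norm_eq_abs, abs_of_pos (Real.exp_pos _)] using hle x hx
  have h2 : MeasureTheory.IntegrableOn f (Set.Iic 0) := by
    have h3 : MeasureTheory.IntegrableOn (fun x => f (-x)) (Set.Iio 0) := by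
      have := (MeasureTheory.Measure.measurePreserving_neg
        (MeasureTheory.volume : MeasureTheory.Measure ℝ)).integrableOn_comp_preimage
        (Homeomorph.neg ℝ).measurableEmbedding (f := f) (s := Set.Ioi 0)
      simpa [Function.comp_def] using this.2 h1
    rw [integrableOn_Iic_iff_integrableOn_Iio]
    simpa only [heven] using h3
  rw [← MeasureTheory.integrableOn_univ, ← Set.Iic_union_Ioi (a := (0 : ℝ))]
  exact h2.union h1

/-! ### Bounds on the potential, eigenfunctions and the translation mode -/

theorem lumpPotential_le_four (a x : ℝ) : lumpPotential a x ≤ 4 := by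
  have := Real.cosh_pos (2 * x)
  have := Real.cosh_pos (2 * a)
  rw [lumpPotential]
  have : 0 ≤ 24 * (1 + Real.cosh (2 * x) * Real.cosh (2 * a)) /
    (Real.cosh (2 * x) + Real.cosh (2 * a)) ^ 2 := by positivity
  linarith

/-- With both hyperbolic cosines at least `1`, the inequality `2(1 + XY) ≤ (X + Y)²` reduces to `X²
+ Y² ≥ 2`. -/
theorem neg_eight_le_lumpPotential (a x : ℝ) : -8 ≤ lumpPotential a x := by
  have h1 := Real.one_le_cosh (2 * x)
  have h2 := Real.one_le_cosh (2 * a)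
  rw [lumpPotential]
  have : 24 * (1 + Real.cosh (2 * x) * Real.cosh (2 * a)) /
    (Real.cosh (2 * x) + Real.cosh (2 * a)) ^ 2 ≤ 12 := by
    rw [div_le_iff₀ (by positivity)]
    nlinarith [sq_nonneg (Real.cosh (2 * x) - Real.cosh (2 * a)), mul_le_mul h1 h2 (by norm_num)
      (by positivity)]
  linarith

/-- The crude threshold yields `cosh 2x ≥ 2x ≥ 24 cosh 2a`. For `lam < 0` the bound gives `U - lam ≥
1`, as needed for exponential decay. -/
theorem two_le_lumpPotential {a x : ℝ} (hx : 12 * Real.cosh (2 * a) ≤ x) :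
    2 ≤ lumpPotential a x := by
  have h1 := Real.one_le_cosh (2 * x)
  have h2 := Real.one_le_cosh (2 * a)
  have h3 : 2 * x ≤ Real.cosh (2 * x) :=
    (Real.self_le_sinh_iff.2 (by linarith)).trans (Real.sinh_lt_cosh _).le
  rw [lumpPotential]
  have : 24 * (1 + Real.cosh (2 * x) * Real.cosh (2 * a)) /
    (Real.cosh (2 * x) + Real.cosh (2 * a)) ^ 2 ≤ 2 := by
    rw [div_le_iff₀ (by positivity)]
    nlinarith [mul_le_mul_of_nonneg_left (by linarith : 24 * Real.cosh (2 * a) ≤ Real.cosh (2 * x))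
      (by linarith : 0 ≤ Real.cosh (2 * x))]
  linarith

theorem continuous_lumpPotential (a : ℝ) : Continuous (lumpPotential a) := by
  have h : ∀ x, (Real.cosh (2 * x) + Real.cosh (2 * a)) ^ 2 ≠ 0 := fun x => by
    have := Real.cosh_pos (2 * x)
    have := Real.cosh_pos (2 * a)
    positivity
  have := Real.continuous_cosh
  unfold lumpPotential
  fun_prop (disch := exact h _)

theorem IsEigenfunction.hasDerivAt {U : ℝ → ℝ} {l : ℝ} {η : ℝ → ℝ} (h : IsEigenfunction U l η) :
    (∀ x, HasDerivAt η (deriv η x) x) ∧ ∀ x, HasDerivAt (deriv η) ((U x - l) * η x) x := by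
  have h2 : ContDiff ℝ (1 + 1) η := h.contDiff
  have h1 := (contDiff_succ_iff_deriv.1 h2)
  refine ⟨fun x => (h1.1 x).hasDerivAt, fun x => ?_⟩
  refine ((h1.2.2.differentiable one_ne_zero) x).hasDerivAt.congr_deriv ?_
  linarith [h.eqn x]

theorem IsEigenfunction.of_hasDerivAt {U : ℝ → ℝ} {l : ℝ} {η η₁ : ℝ → ℝ} (hU : Continuous U)
    (hη : ∀ x, HasDerivAt η (η₁ x) x) (hη₁ : ∀ x, HasDerivAt η₁ ((U x - l) * η x) x)
    (hint : MeasureTheory.Integrable fun x => η x ^ 2) (h0 : η ≠ 0) : IsEigenfunction U l η := by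
  have hd : deriv η = η₁ := funext fun x => (hη x).deriv
  have hd₁ : deriv η₁ = fun x => (U x - l) * η x := funext fun x => (hη₁ x).deriv
  have hc : Continuous η := continuous_iff_continuousAt.2 fun x => (hη x).continuousAt
  refine ⟨?_, ?_, h0, fun x => ?_⟩
  · have : ContDiff ℝ (1 + 1) η := by
      refine contDiff_succ_iff_deriv.2 ⟨fun x => (hη x).differentiableAt, by simp, ?_⟩
      rw [hd]
      refine contDiff_one_iff_deriv.2 ⟨fun x => (hη₁ x).differentiableAt, ?_⟩
      rw [hd₁]
      fun_prop
    exact this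
  · exact (MeasureTheory.memLp_two_iff_integrable_sq hc.aestronglyMeasurable).2 hint
  · rw [hd, hd₁]; ring

/-- The translation mode of the lump, an odd eigenfunction with eigenvalue `0`. -/
theorem exists_zero_mode (a : ℝ) : ∃ η η₁ : ℝ → ℝ, (∀ x, HasDerivAt η (η₁ x) x) ∧
    (∀ x, HasDerivAt η₁ (lumpPotential a x * η x) x) ∧
    (MeasureTheory.Integrable fun x => η x ^ 2) ∧ η 0 = 0 ∧ ∃ x, η x ≠ 0 := by
  set A := Real.cosh (2 * a) with hA
  have hA0 : 0 < A := Real.cosh_pos _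
  have hpos : ∀ x, 0 < Real.cosh (2 * x) + A := fun x => add_pos (Real.cosh_pos _) hA0
  have hsh : ∀ x : ℝ, HasDerivAt (fun x => Real.sinh (2 * x)) (2 * Real.cosh (2 * x)) x := fun x =>
    ((Real.hasDerivAt_sinh (2 * x)).comp x ((hasDerivAt_id x).const_mul 2)).congr_deriv
      (by simp; ring)
  have hch : ∀ x : ℝ, HasDerivAt (fun x => Real.cosh (2 * x)) (2 * Real.sinh (2 * x)) x := fun x =>
    ((Real.hasDerivAt_cosh (2 * x)).comp x ((hasDerivAt_id x).const_mul 2)).congr_deriv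
      (by simp; ring)
  -- This is the derivative of the lump with its constant factor dropped.
  have hη : ∀ x, HasDerivAt (fun x => Real.sinh (2 * x) / (Real.cosh (2 * x) + A) ^ 2)
      ((2 * A * Real.cosh (2 * x) - 2 * Real.cosh (2 * x) ^ 2 + 4) /
        (Real.cosh (2 * x) + A) ^ 3) x := fun x => by
    have h := (hpos x).ne'
    refine ((hsh x).div (((hch x).add_const A).pow 2) (pow_ne_zero 2 h)).congr_deriv ?_
    have hs := Real.sinh_sq (2 * x)
    simp only [Pi.pow_apply]
    field_simp
    push_cast
    linear_combination (-4) * (Real.cosh (2 * x) + A) * hs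
  refine ⟨_, _, hη, fun x => ?_, ?_, by simp, 1, ?_⟩
  · have h := (hpos x).ne'
    refine (((((hch x).const_mul (2 * A)).sub (((hch x).pow 2).const_mul 2)).add_const 4).div
      (((hch x).add_const A).pow 3) (pow_ne_zero 3 h)).congr_deriv ?_
    rw [lumpPotential, ← hA]
    simp only [Pi.pow_apply, Pi.sub_apply]
    field_simp
    push_cast
    ring
  · refine integrable_of_even_of_le_exp (C := 2) (X := 0)
      ((continuous_iff_continuousAt.2 fun x => (hη x).continuousAt).pow 2)
      (fun x => by simp [neg_div]) fun x hx => ?_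
    have hc1 := Real.one_le_cosh (2 * x)
    have hS : Real.cosh (2 * x) ≤ Real.cosh (2 * x) + A := by linarith
    have hs : Real.sinh (2 * x) ^ 2 ≤ Real.cosh (2 * x) ^ 2 := by
      rw [Real.sinh_sq]; linarith
    rw [abs_of_nonneg (sq_nonneg _), div_pow, ← pow_mul]
    calc Real.sinh (2 * x) ^ 2 / (Real.cosh (2 * x) + A) ^ (2 * 2)
        ≤ Real.cosh (2 * x) ^ 2 / Real.cosh (2 * x) ^ (2 * 2) := by gcongr
      _ = 1 / Real.cosh (2 * x) * (1 / Real.cosh (2 * x)) := by field_simp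
      _ ≤ 1 / Real.cosh (2 * x) * 1 := by
        gcongr
        rw [div_le_one (by linarith)]; exact hc1
      _ ≤ 1 / (Real.exp x / 2) := by
        rw [mul_one]
        gcongr
        rw [Real.cosh_eq]
        have h1 : Real.exp x ≤ Real.exp (2 * x) := Real.exp_le_exp.2 (by linarith)
        have h2 := Real.exp_pos (-(2 * x))
        linarith
      _ = 2 * Real.exp (-x) := by rw [Real.exp_neg]; field_simp
  · have h1 : 0 < Real.sinh (2 * 1) := Real.sinh_pos_iff.2 (by norm_num)
    have h2 := hpos 1
    positivity

/-! ### Shooting in the spectral parameter -/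

section Shooting

variable {a : ℝ}

/-- The even solution of `-u'' + U u = lam u` for `lam ≤ 4`. -/
theorem hasDerivAt_evenSolution (ha : a ≠ 0) {lam : ℝ} (hlam : lam ≤ 4) :
    (∀ x, HasDerivAt (lumpMode a (Real.sqrt (4 - lam))) (lumpModeDeriv a (Real.sqrt (4 - lam)) x) x)
    ∧ ∀ x, HasDerivAt (lumpModeDeriv a (Real.sqrt (4 - lam)))
      ((lumpPotential a x - lam) * lumpMode a (Real.sqrt (4 - lam)) x) x := by
  refine ⟨hasDerivAt_lumpMode (Real.sqrt_nonneg _), fun x => ?_⟩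
  have h := hasDerivAt_lumpModeDeriv ha (Real.sqrt_nonneg (4 - lam)) x
  rw [Real.sq_sqrt (by linarith), sub_sub_cancel] at h
  exact h

theorem eq_const_mul_lumpMode (ha : a ≠ 0) {lam l : ℝ} (hlam : lam < 4) (hl : l ≤ lam)
    (hpos : ∀ x, 0 < lumpMode a (Real.sqrt (4 - lam)) x) {η η₁ : ℝ → ℝ}
    (hη : ∀ x, HasDerivAt η (η₁ x) x)
    (hη₁ : ∀ x, HasDerivAt η₁ ((lumpPotential a x - l) * η x) x)
    (hint : MeasureTheory.Integrable fun x => η x ^ 2) :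
    (∀ x, (lam - l) * η x ^ 2 = 0) ∧ ∃ c, ∀ x, η x = c * lumpMode a (Real.sqrt (4 - lam)) x := by
  obtain ⟨h1, h2⟩ := hasDerivAt_evenSolution ha hlam.le
  refine eq_const_mul_of_pos_solution (V := fun x => lumpPotential a x - lam)
    (K := Real.sqrt (4 - lam)) (Real.sqrt_pos.2 (by linarith)) (fun x => ?_) h1 h2 hpos
    (by linarith) hη (fun x => by simpa using hη₁ x) hint
  rw [Real.sq_sqrt (by linarith)]
  linarith [lumpPotential_le_four a x]

theorem not_pos_at_zero (ha : a ≠ 0) : ¬ ∀ x, 0 < lumpMode a (Real.sqrt (4 - 0)) x := by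
  intro hpos
  obtain ⟨η, η₁, hη, hη₁, hint, h0, x, hx⟩ := exists_zero_mode a
  obtain ⟨-, c, hc⟩ := eq_const_mul_lumpMode ha (by norm_num) le_rfl hpos hη
    (by simpa using hη₁) hint
  have h1 := hc 0
  rw [h0] at h1
  have hc0 : c = 0 := by
    rcases mul_eq_zero.1 h1.symm with h | h
    · exact h
    · exact absurd h (hpos 0).ne'
  exact hx (by rw [hc, hc0, zero_mul])

theorem lumpMode_pos_of_le (ha : a ≠ 0) {lam : ℝ} (hlam : lam ≤ -8) (x : ℝ) :
    0 < lumpMode a (Real.sqrt (4 - lam)) x := by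
  obtain ⟨h1, h2⟩ := hasDerivAt_evenSolution ha (by linarith : lam ≤ 4)
  have hp : ∀ x, 0 ≤ x → 0 < lumpMode a (Real.sqrt (4 - lam)) x :=
    pos_of_growth (fun x _ => by linarith [neg_eight_le_lumpPotential a x]) h1 h2
      (lumpMode_zero_pos _ _) (lumpModeDeriv_zero _ _).ge
  rcases le_total 0 x with h | h
  · exact hp x h
  · rw [← lumpMode_neg]; exact hp _ (by linarith)

/-- A zero of a nonnegative solution is a minimum, so its derivative vanishes there too; uniqueness
would then make the solution vanish at the origin. -/
theorem lumpMode_pos_of_nonneg (ha : a ≠ 0) {lam : ℝ} (hlam : lam ≤ 4)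
    (h : ∀ x, 0 ≤ lumpMode a (Real.sqrt (4 - lam)) x) (x : ℝ) :
    0 < lumpMode a (Real.sqrt (4 - lam)) x := by
  refine (h x).lt_of_ne fun h0 => ?_
  obtain ⟨h1, h2⟩ := hasDerivAt_evenSolution ha hlam
  have hmin : IsLocalMin (lumpMode a (Real.sqrt (4 - lam))) x :=
    Filter.Eventually.of_forall fun y => by rw [← h0]; exact h y
  have hd := hmin.hasDerivAt_eq_zero (h1 x)
  have hb : ∀ x, |lumpPotential a x - lam| ≤ 12 + |lam| := fun x =>
    abs_le.2 ⟨by linarith [neg_eight_le_lumpPotential a x, le_abs_self lam], by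
      linarith [lumpPotential_le_four a x, neg_abs_le lam]⟩
  exact (lumpMode_zero_pos a (Real.sqrt (4 - lam))).ne'
    (linearODE_eq_zero hb h1 h2 h0.symm hd 0)

open Filter Topology in
/-- If the even solution at `lam₀ < 0` is positive, and increasing somewhere in the region where the
potential is positive, then the even solutions for nearby `lam` are positive too. -/
theorem eventually_pos_of_deriv_pos (ha : a ≠ 0) {lam₀ X : ℝ} (hlam : lam₀ < 0)
    (hX : 12 * Real.cosh (2 * a) ≤ X) (hpos : ∀ x, 0 < lumpMode a (Real.sqrt (4 - lam₀)) x)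
    (hd : 0 < lumpModeDeriv a (Real.sqrt (4 - lam₀)) X) :
    ∀ᶠ lam in 𝓝 lam₀, ∀ x, 0 < lumpMode a (Real.sqrt (4 - lam)) x := by
  -- Positivity on the compact interval `[0, X]` is stable in `lam`; beyond `X` growth preserves it,
  -- and evenness covers the negative half line.
  have h1 : ∀ᶠ lam in 𝓝 lam₀, ∀ x ∈ Set.Icc 0 X, 0 < lumpMode a (Real.sqrt (4 - lam)) x := by
    refine isCompact_Icc.eventually_forall_of_forall_eventually fun x _ => ?_
    exact (continuous_lumpMode a).continuousAt.eventually_const_lt (hpos x)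
  have h2 : ∀ᶠ lam in 𝓝 lam₀, 0 < lumpModeDeriv a (Real.sqrt (4 - lam)) X :=
    ((continuous_lumpModeDeriv a).comp
      (Continuous.prodMk_left X)).continuousAt.eventually_const_lt hd
  filter_upwards [h1, h2, eventually_lt_nhds hlam] with lam h1 h2 h3
  obtain ⟨e1, e2⟩ := hasDerivAt_evenSolution ha (by linarith : lam ≤ 4)
  have hX0 : 0 ≤ X := by linarith [Real.cosh_pos (2 * a)]
  have hp : ∀ x, 0 ≤ x → 0 < lumpMode a (Real.sqrt (4 - lam)) x := fun x hx => by
    rcases le_total x X with h | h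
    · exact h1 x ⟨hx, h⟩
    · exact pos_of_growth (fun y hy => by linarith [two_le_lumpPotential (hX.trans hy)]) e1 e2
        (h1 X ⟨hX0, le_rfl⟩) h2.le x h
  intro x
  rcases le_total 0 x with h | h
  · exact hp x h
  · rw [← lumpMode_neg]; exact hp _ (by linarith)

-- The bound state sits at the supremum of the parameters with a positive even solution: positivity
-- survives in the limit, and maximality excludes growth at infinity.
open Filter Topology in
theorem exists_pos_bound_state (ha : a ≠ 0) : ∃ lam < 0,
    (∀ x, 0 < lumpMode a (Real.sqrt (4 - lam)) x) ∧
      MeasureTheory.Integrable fun x => lumpMode a (Real.sqrt (4 - lam)) x ^ 2 := by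
  set S : Set ℝ := {lam | lam ≤ 0 ∧ ∀ x, 0 < lumpMode a (Real.sqrt (4 - lam)) x} with hS
  have hne : S.Nonempty := ⟨-8, by norm_num, lumpMode_pos_of_le ha le_rfl⟩
  have hbdd : BddAbove S := ⟨0, fun l hl => hl.1⟩
  set lam₀ := sSup S with hlam₀
  have hle : lam₀ ≤ 0 := csSup_le hne fun l hl => hl.1
  have hpos : ∀ x, 0 < lumpMode a (Real.sqrt (4 - lam₀)) x := by
    refine lumpMode_pos_of_nonneg ha (by linarith) fun x => ?_
    have hcl : IsClosed {lam | 0 ≤ lumpMode a (Real.sqrt (4 - lam)) x} :=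
      isClosed_Ici.preimage ((continuous_lumpMode a).comp (Continuous.prodMk_left x))
    exact closure_minimal (fun l hl => (hl.2 x).le) hcl (csSup_mem_closure hne hbdd)
  have hlt : lam₀ < 0 := hle.lt_of_ne fun h => not_pos_at_zero ha (h ▸ hpos)
  -- Growth at such a point would put `lam₀ + ε / 2` into `S`, above its supremum.
  have hdec : ∀ X, 12 * Real.cosh (2 * a) ≤ X →
      lumpModeDeriv a (Real.sqrt (4 - lam₀)) X ≤ 0 := fun X hX => by
    by_contra! hd
    have hev := (eventually_pos_of_deriv_pos ha hlt hX hpos hd).and (eventually_lt_nhds hlt)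
    obtain ⟨ε, hε, hball⟩ := Metric.eventually_nhds_iff.1 hev
    have h1 := hball (y := lam₀ + ε / 2) (by
      rw [Real.dist_eq, add_sub_cancel_left, abs_of_pos (by linarith)]; linarith)
    have h2 : lam₀ + ε / 2 ≤ lam₀ := le_csSup hbdd ⟨h1.2.le, h1.1⟩
    linarith
  obtain ⟨e1, e2⟩ := hasDerivAt_evenSolution ha (by linarith : lam₀ ≤ 4)
  refine ⟨lam₀, hlt, hpos, ?_⟩
  set X := 12 * Real.cosh (2 * a) with hX
  have hX0 : 0 < X := by have := Real.cosh_pos (2 * a); positivity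
  have hdecay := exp_decay_of_antitone (X := X)
    (fun x hx => by linarith [two_le_lumpPotential hx]) e1 e2 (fun x _ => hpos x) hdec
  refine integrable_of_even_of_le_exp
    (C := (lumpMode a (Real.sqrt (4 - lam₀)) X * Real.exp X) ^ 2) (X := X)
    ((continuous_iff_continuousAt.2 fun x => (e1 x).continuousAt).pow 2)
    (fun x => by rw [lumpMode_neg]) fun x hx => ?_
  rw [abs_of_nonneg (sq_nonneg _)]
  refine (pow_le_pow_left₀ (hpos x).le (hdecay x hx) 2).trans ?_
  rw [mul_pow]
  gcongr
  have : Real.exp (-x) ≤ 1 := Real.exp_le_one_iff.2 (by linarith)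
  nlinarith [Real.exp_pos (-x)]

end Shooting

/-! ### The ground state -/

theorem theorem2 (a : ℝ) (ha : 0 < a) :
    (∃ lam : ℝ, IsGroundStateEigenvalue (lumpPotential a) lam) ∧
    ∀ lam : ℝ, IsGroundStateEigenvalue (lumpPotential a) lam →
      lam < 0 ∧
      (∀ x : ℝ, Summable fun n : ℕ =>
        heunCoeff (1 - heunP a) (heunAlpha lam * heunBeta lam - heunQ a lam)
          (heunAlpha lam) (heunBeta lam) heunDelta (heunGamma lam) n * (Real.tanh x ^ 2) ^ n) ∧
      (∀ η : ℝ → ℝ, IsEigenfunction (lumpPotential a) lam η ↔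
        ∃ c : ℝ, c ≠ 0 ∧ ∀ x : ℝ, η x = c * heunMode a lam x) ∧
      (∀ x : ℝ, heunMode a lam (-x) = heunMode a lam x) ∧
      (∀ x : ℝ, heunMode a lam x ≠ 0) := by
  obtain ⟨lam₀, hlt, hpos, hint⟩ := exists_pos_bound_state ha.ne'
  obtain ⟨e1, e2⟩ := hasDerivAt_evenSolution ha.ne' (by linarith : lam₀ ≤ 4)
  have hmul : ∀ c : ℝ, c ≠ 0 → IsEigenfunction (lumpPotential a) lam₀
      fun x => c * lumpMode a (Real.sqrt (4 - lam₀)) x := fun c hc => by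
    refine .of_hasDerivAt (continuous_lumpPotential a) (fun x => (e1 x).const_mul c)
      (fun x => ((e2 x).const_mul c).congr_deriv (by ring)) ?_ fun h => ?_
    · simpa only [mul_pow] using hint.const_mul (c ^ 2)
    · exact mul_ne_zero hc (hpos 0).ne' (congrFun h 0)
  have hground : IsGroundStateEigenvalue (lumpPotential a) lam₀ := by
    refine ⟨⟨_, hmul 1 one_ne_zero⟩, fun l hl => ?_⟩
    obtain ⟨η, hη⟩ := hl
    -- For an eigenvalue `l < lam₀`, Picone's argument makes `(lam₀ - l) η²` vanish identically, so
    -- `η = 0`.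
    by_contra! hll
    obtain ⟨d1, d2⟩ := hη.hasDerivAt
    obtain ⟨h0, -⟩ := eq_const_mul_lumpMode ha.ne' (by linarith) hll.le hpos d1 d2
      hη.memLp.integrable_sq
    refine hη.ne_zero (funext fun x => ?_)
    have := (mul_eq_zero.1 (h0 x)).resolve_left (by linarith)
    exact pow_eq_zero_iff two_ne_zero |>.1 this
  refine ⟨⟨lam₀, hground⟩, fun lam hlam => ?_⟩
  obtain rfl : lam = lam₀ := hlam.unique hground
  simp only [heunMode_eq_lumpMode]
  refine ⟨hlt, fun x => ?_, fun η => ⟨fun hη => ?_, ?_⟩, fun x => lumpMode_neg _ _ _,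
    fun x => (hpos x).ne'⟩
  · exact (uniformUnitRadius_modeCoeff a (Real.sqrt (4 - lam))).summable
      ⟨Real.sqrt_nonneg _, le_rfl⟩ (abs_tanh_sq_lt_one x)
  · obtain ⟨d1, d2⟩ := hη.hasDerivAt
    obtain ⟨-, c, hc⟩ := eq_const_mul_lumpMode ha.ne' (by linarith) le_rfl hpos d1 d2
      hη.memLp.integrable_sq
    refine ⟨c, fun h => hη.ne_zero (funext fun x => ?_), hc⟩
    rw [hc, h, zero_mul, Pi.zero_apply]
  · rintro ⟨c, hc, h⟩
    rw [funext h]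
    exact hmul c hc
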